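/- Let $n,m\ge 0$ be integers. For $r>0$ let $\mathcal O_r$ be the set of Hermitian $(m+1)\times(m+1)$ matrices $r\,w\otimes w^*$ with $w\in\mathbb C^{m+1}$ a unit vector. For $\mathbf r=(r_1,\dots,r_n)\in(\mathbb R_{>0})^n$ let $$\widetilde M_{\mathbf r}=\Big\{\mathbf e=(e_1,\dots,e_n)\;\Big|\; e_i\in\mathcal O_{r_i},\ \sum_{i=1}^n e_i=\Lambda\,\mathbb I\Big\},\qquad \Lambda=\frac1{m+1}\sum_{i=1}^n r_i,$$ be the space of closed polygons with side lengths $\mathbf r$, let $M_{\mathbf r}=\widetilde M_{\mathbf r}/U(m+1)$ be its quotient by diagonal conjugation, let $\mathrm{CPol}=\bigcup_{\mathbf r\in(\mathbb R_{>0})^n}\widetilde M_{\mathbf r}$, and let $\overline{\mathbf s}:\mathrm{CPol}\to\mathbb R^n$ be the side-length map, $\overline{\mathbf s}(\mathbf e)=\mathbf r$ for $\mathbf e\in\widetilde M_{\mathbf r}$. A value $\overline{\mathbf s}(\mathbf e)$ is critical if, for some $\mathbf e\in\mathrm{CPol}$ with this value, $T_{\mathbf e}\overline{\mathbf s}:T_{\mathbf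 e}\mathrm{CPol}\to\mathbb R^n$ is not onto, where $T_{\mathbf e}\mathrm{CPol}$ consists of the velocities of smooth curves in $\mathrm{CPol}$ through $\mathbf e$. Let $C(n,m+1)=\{\mathbf r\in(\mathbb R_{>0})^n\mid M_{\mathbf r}\neq\emptyset\}$. For $1\le k\le m$ and a partition $\{1,\dots,n\}=I\sqcup J$ into two nonempty sets, the wall $W_{I,J,k}$ is the set of $\mathbf r\in C(n,m+1)$ with $k\sum_{i\in I}r_i=(m-k+1)\sum_{j\in J}r_j$. A chamber is a connected component of the complement in $C(n,m+1)$ of the union of all walls. Smoothness of maps on subsets of finite-dimensional real vector spaces means that they extend locally to smooth maps on open sets. Quotients by $U(m+1)$ carry the quotient smooth structure: a real function is smooth if its pull-back to the space of polygons is smooth; a diffeomorphism between such spaces is a homeomorphism that identifies the (germs of) smooth functions. Then: 1. The set of critical values of $\overline{\mathbf s}$ is the union of the walls $W_{I,J,k}$. 2. Over each chamber $\Delta$ the side-length map is a trivial smooth fibre bundle, on $\mathrm{CPol}$ as well as on $\mathrm{CPol}/U(m+1)$: for every $\mathbf r\in\Delta$ there are a diffeomorphism $\overline{\mathbf s}^{-1}(\Delta)\cong\Delta\times\widetilde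 M_{\mathbf r}$ and a diffeomorphism $\overline{\mathbf s}^{-1}(\Delta)/U(m+1)\cong\Delta\times M_{\mathbf r}$, both compatible with the maps to $\Delta$ (here $\Delta\times M_{\mathbf r}$ is regarded as the quotient of $\Delta\times\widetilde M_{\mathbf r}$). 3. If $\mathbf r$ and $\mathbf r'$ lie in the same chamber, then $M_{\mathbf r}$ and $M_{\mathbf r'}$ are diffeomorphic. -/

import Mathlib

open scoped ContDiff Matrix

/- The smooth structure of a finite-dimensional space of matrices does not depend on the norm; the
entrywise sup norm is used, whose topology is definitionally the usual one. -/
attribute [local instance] Matrix.normedAddCommGroup Matrix.normedSpace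

noncomputable section

namespace PolygonSpace

/-! ### Smooth maps on subsets of normed spaces and on quotients of such subsets -/

section Smooth

variable {E F : Type*} [NormedAddCommGroup E] [NormedSpace ℝ E]
  [NormedAddCommGroup F] [NormedSpace ℝ F]

/-- A map `f` on a subset `X ⊆ E` is smooth near `x ∈ X` if, on a neighbourhood of `x`, it is the
restriction of a smooth map defined on an open subset of `E`. -/
def SmoothNear {X : Set E} (f : X → F) (x : X) : Prop :=
  ∃ U : Set E, IsOpen U ∧ (x : E) ∈ U ∧
    ∃ g : E → F, ContDiffOn ℝ ∞ g U ∧ ∀ y : X, (y : E) ∈ U → f y = g y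

/-- A bijection between subsets of normed spaces is a diffeomorphism if it and its inverse are
smooth. -/
def IsDiffeo {X : Set E} {Y : Set F} (φ : X ≃ Y) : Prop :=
  (∀ x : X, SmoothNear (fun z : X => (φ z : F)) x) ∧
    (∀ y : Y, SmoothNear (fun z : Y => (φ.symm z : E)) y)

/-- The quotient smooth structure on the target of a projection `p : X → P`: a real function on
`P` is smooth near `a` if its pull-back to `X ⊆ E` is smooth near every point of the fibre
over `a`. -/
def QuotientSmoothNear {X : Set E} {P : Type*} (p : X → P) (f : P → ℝ) (a : P) : Prop :=
  ∀ x : X, p x = a → SmoothNear (fun z : X => f (p z)) x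

/-- A homeomorphism between two quotient spaces is a diffeomorphism if it identifies their germs
of smooth functions. -/
def IsQuotientDiffeo {X : Set E} {Y : Set F} {P Q : Type*} [TopologicalSpace P]
    [TopologicalSpace Q] (p : X → P) (q : Y → Q) (φ : P ≃ₜ Q) : Prop :=
  ∀ (f : Q → ℝ) (a : P),
    QuotientSmoothNear q f (φ a) ↔ QuotientSmoothNear p (fun b => f (φ b)) a

/-- The tangent vectors of a subset `X ⊆ E` at `x`: the velocities at time `0` of the smooth
curves in `X` through `x`. -/
def tangentVectors (X : Set E) (x : E) : Set E :=
  {v | ∃ (γ : ℝ → E) (ε : ℝ), 0 < ε ∧ ContDiffOn ℝ ∞ γ (Set.Ioo (-ε) ε) ∧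
    (∀ t ∈ Set.Ioo (-ε) ε, γ t ∈ X) ∧ γ 0 = x ∧ HasDerivAt γ v 0}

/-- The critical values of the restriction to `X ⊆ E` of a smooth map `f : E → F`: the values at
the points of `X` where the derivative does not map the tangent vectors of `X` onto `F`. -/
def criticalValues (X : Set E) (f : E → F) : Set F :=
  {y | ∃ x ∈ X, f x = y ∧ ¬ Set.SurjOn (fderiv ℝ f x) (tangentVectors X x) Set.univ}

end Smooth

/-! ### Polygons of Hermitian matrices -/

/-- `n`-tuples of complex `(m+1) × (m+1)` matrices. -/
abbrev Tuple (n m : ℕ) : Type := Fin n → Matrix (Fin (m + 1)) (Fin (m + 1)) ℂ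

/-- The orbit `𝒪_r` of the matrices `r w ⊗ w*` with `w` a unit vector of `ℂ^(m+1)`. -/
def edgeOrbit (m : ℕ) (r : ℝ) : Set (Matrix (Fin (m + 1)) (Fin (m + 1)) ℂ) :=
  {e | ∃ w : Fin (m + 1) → ℂ, star w ⬝ᵥ w = 1 ∧ e = (r : ℂ) • Matrix.vecMulVec w (star w)}

/-- The linkages with side lengths `r`. -/
def linkages {n : ℕ} (m : ℕ) (r : Fin n → ℝ) : Set (Tuple n m) :=
  {e | ∀ i, e i ∈ edgeOrbit m (r i)}

/-- The closed polygons with side lengths `r`: linkages whose edges add up to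
`Λ I`, where `Λ = (∑ r_i) / (m+1)`. -/
def closedPolygons {n : ℕ} (m : ℕ) (r : Fin n → ℝ) : Set (Tuple n m) :=
  {e | e ∈ linkages m r ∧
    ∑ i, e i = (((∑ i, r i) / ((m : ℝ) + 1) : ℝ) : ℂ) •
      (1 : Matrix (Fin (m + 1)) (Fin (m + 1)) ℂ)}

/-- The space `CPol` of closed polygons with arbitrary positive side lengths. -/
def CPol (n m : ℕ) : Set (Tuple n m) :=
  {e | ∃ r : Fin n → ℝ, (∀ i, 0 < r i) ∧ e ∈ closedPolygons m r}

/-- The side-length map; the length of the edge `r w ⊗ w*` is its trace `r`. -/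
def sideLength {n m : ℕ} (e : Tuple n m) : Fin n → ℝ := fun i => (e i).trace.re

theorem sideLength_of_mem {n m : ℕ} {r : Fin n → ℝ} {e : Tuple n m}
    (he : e ∈ linkages m r) : sideLength e = r := by
  funext i
  obtain ⟨w, hw, h⟩ := he i
  have h1 : w ⬝ᵥ star w = 1 := by rw [dotProduct_comm]; exact hw
  simp [sideLength, h, Matrix.trace_smul, Matrix.trace_vecMulVec, h1]

/-- On a set of tuples: being related by the diagonal conjugation action of `U(m+1)`. -/
def conjSetoid {n m : ℕ} (X : Set (Tuple n m)) : Setoid X where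
  r e e' := ∃ u ∈ Matrix.unitaryGroup (Fin (m + 1)) ℂ,
    ∀ i, (e' : Tuple n m) i = u * (e : Tuple n m) i * star u
  iseqv :=
    { refl := fun e => ⟨1, one_mem _, fun i => by simp⟩
      symm := by
        rintro e e' ⟨u, hu, h⟩
        have h2 : star u * u = 1 := Matrix.mem_unitaryGroup_iff'.1 hu
        refine ⟨star u, Unitary.star_mem hu, fun i => ?_⟩
        rw [h i, star_star, ← mul_assoc, ← mul_assoc, h2, one_mul, mul_assoc, h2, mul_one]
      trans := by
        rintro e e' e'' ⟨u, hu, h⟩ ⟨v, hv, h'⟩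
        refine ⟨v * u, mul_mem hv hu, fun i => ?_⟩
        rw [h' i, h i, star_mul]
        simp only [mul_assoc] }

/-- The quotient of a conjugation-invariant set of tuples by `U(m+1)`, with the quotient
topology. -/
abbrev OrbitSpace {n m : ℕ} (X : Set (Tuple n m)) : Type := Quotient (conjSetoid X)

/-- The projection to the orbit space. -/
def toOrbit {n m : ℕ} (X : Set (Tuple n m)) : X → OrbitSpace X := Quotient.mk (conjSetoid X)

/-- The moduli space `M_r` of closed polygons with side lengths `r`. -/
abbrev Moduli {n : ℕ} (m : ℕ) (r : Fin n → ℝ) : Type := OrbitSpace (closedPolygons m r)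

/-- The moduli spaces `M_r` and `M_{r'}` are diffeomorphic. -/
def ModuliDiffeomorphic {n : ℕ} (m : ℕ) (r r' : Fin n → ℝ) : Prop :=
  ∃ φ : Moduli m r ≃ₜ Moduli m r',
    IsQuotientDiffeo (toOrbit (closedPolygons m r)) (toOrbit (closedPolygons m r')) φ

/-! ### Walls and chambers -/

/-- The cone `C(n, m+1)` of the positive `r` for which `M_r` is nonempty. -/
def cone (n m : ℕ) : Set (Fin n → ℝ) := {r | (∀ i, 0 < r i) ∧ Nonempty (Moduli m r)}

/-- The hyperplane (in the positive orthant) `H_{I,J,k}`. -/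
def hyperplane {n : ℕ} (m : ℕ) (I J : Finset (Fin n)) (k : ℕ) : Set (Fin n → ℝ) :=
  {r | (∀ i, 0 < r i) ∧
    (k : ℝ) * ∑ i ∈ I, r i = ((m : ℝ) - (k : ℝ) + 1) * ∑ j ∈ J, r j}

/-- The wall `W_{I,J,k}`. -/
def wall {n : ℕ} (m : ℕ) (I J : Finset (Fin n)) (k : ℕ) : Set (Fin n → ℝ) :=
  hyperplane m I J k ∩ cone n m

/-- `I ∪ J` is a partition of the index set into two proper subsets. -/
def IsProperPartition {n : ℕ} (I J : Finset (Fin n)) : Prop :=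
  Disjoint I J ∧ I ∪ J = Finset.univ ∧ I.Nonempty ∧ J.Nonempty

/-- The union of all walls `W_{I,J,k}`, `1 ≤ k ≤ m`. -/
def wallUnion (n m : ℕ) : Set (Fin n → ℝ) :=
  {r | ∃ (I J : Finset (Fin n)) (k : ℕ),
    IsProperPartition I J ∧ 1 ≤ k ∧ k ≤ m ∧ r ∈ wall m I J k}

/-- A chamber: a connected component of the complement of the walls in `C(n, m+1)`. -/
def IsChamber (n m : ℕ) (D : Set (Fin n → ℝ)) : Prop :=
  ∃ r ∈ cone n m \ wallUnion n m, D = connectedComponentIn (cone n m \ wallUnion n m) r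

/-! ### The side-length map over a set of side lengths -/

/-- The part of `CPol` with side lengths in `D`. -/
def polygonsOver {n : ℕ} (m : ℕ) (D : Set (Fin n → ℝ)) : Set (Tuple n m) :=
  {e | e ∈ CPol n m ∧ sideLength e ∈ D}

/-- The side-length map `CPol → ℝ^n` is over `D` a trivial smooth fibre bundle with fibre the space
of closed polygons with side lengths `r`. -/
def IsTrivialBundleOver {n : ℕ} (m : ℕ) (D : Set (Fin n → ℝ)) (r : Fin n → ℝ) : Prop :=
  ∃ φ : polygonsOver m D ≃ (D ×ˢ closedPolygons m r : Set ((Fin n → ℝ) × Tuple n m)),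
    IsDiffeo φ ∧
      ∀ e, (φ e : (Fin n → ℝ) × Tuple n m).1 = sideLength (e : Tuple n m)

/-- The map induced by the side-length map on `CPol / U(m+1)` is over `D` a trivial smooth fibre
bundle with fibre `M_r`. The product `D × M_r` has the smooth structure of the quotient of
`D × (closed polygons with side lengths r)`. -/
def IsTrivialQuotientBundleOver {n : ℕ} (m : ℕ) (D : Set (Fin n → ℝ)) (r : Fin n → ℝ) : Prop :=
  ∃ φ : OrbitSpace (polygonsOver m D) ≃ₜ D × Moduli m r,
    IsQuotientDiffeo (toOrbit (polygonsOver m D))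
      (fun z : (D ×ˢ closedPolygons m r : Set ((Fin n → ℝ) × Tuple n m)) =>
        ((⟨z.1.1, z.2.1⟩, toOrbit (closedPolygons m r) ⟨z.1.2, z.2.2⟩) : D × Moduli m r)) φ ∧
      ∀ e, ((φ (toOrbit (polygonsOver m D) e)).1 : Fin n → ℝ) = sideLength (e : Tuple n m)

end PolygonSpace

end

/-!
The key is that closed polygons can be moved between side lengths by an explicit transport, and
that the walls are exactly where this transport breaks down.

Let `e` be a closed polygon with edges `eᵢ = sᵢ wᵢ ⊗ wᵢ*`, and let `g` be a positive definite
matrix. Moving every line `ℂ wᵢ` by `g` gives a linkage `rescale r g e` with any prescribed side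
lengths `r`; the matrix `g` *balances* `(r, e)` if this linkage is a closed polygon. Everything
rests on one observation (`sum_ne_of_not_mem_wallUnion`, `eq_smul_one_of_mul_edge`): if `r` lies on
no wall, then a Hermitian matrix which has all edges of a closed polygon with side lengths `r` as
eigenvectors is a scalar. For otherwise the edges in one of its eigenspaces, of dimension `d`,
would add up to `Λ` times the projection to that eigenspace, and taking traces one would find
`∑_{i ∈ I} rᵢ = d Λ`, the equation of a wall. Four consequences follow off the walls.

* Uniqueness (`Balances.rescale_eq`): there is at most one balanced polygon `rescale r g e`. For two
  of them, comparison of the traces of the closing conditions gives equality in the Cauchy-Schwarz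
  inequality `⟨w, H w⟩ ⟨w, H⁻¹ w⟩ ≥ 1` for every edge.
* Nondegeneracy (`exists_local_balancing`): the balancing equation satisfies the hypothesis of the
  implicit function theorem, so that `g` can locally be chosen to depend analytically on `(r, e)`.
* Closedness (`balances_of_tendsto`): limits of normalized balancing matrices are invertible, since
  the edges in the kernel of a singular limit would again satisfy the equation of a wall.
* Existence (`exists_balances`): the side lengths in a chamber for which `e` can be balanced form a
  nonempty open and closed set, hence the whole chamber.

So the balanced polygon is a smooth function of `(r, e)`, equivariant under conjugation by
uniqueness. The transport from `s` to `r` followed by the transport back is the identity because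
`g⁻¹` undoes what `g` does. Trivializations of both bundles and diffeomorphisms of the moduli spaces
are restrictions of this one map (`exists_isTransport`).

Applied at `g = 1`, nondegeneracy also shows that a polygon with side lengths off the walls can be
deformed with any prescribed velocity of the side lengths. Conversely, for `r` on a wall there is a
polygon that is an orthogonal direct sum of two closed polygons (`exists_decomposable`, by a
Schur-Horn type construction of frames with prescribed lengths, `exists_frame`). If `Q` is the
projection to one of the two summands, then `tr (Q eᵢ)` is extremal at this polygon for every `i`,
and therefore the velocities of the side lengths satisfy the equation of the wall.
-/

noncomputable section

namespace PolygonSpace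

open Matrix Filter
open scoped ComplexOrder Topology

variable {n m : ℕ}

/-! ### Linear algebra of Hermitian matrices -/

theorem trace_mul_smul_vecMulVec (A : Matrix (Fin (m + 1)) (Fin (m + 1)) ℂ) (c : ℂ)
    (w : Fin (m + 1) → ℂ) :
    (A * (c • vecMulVec w (star w))).trace = c * (star w ⬝ᵥ A *ᵥ w) := by
  rw [Matrix.mul_smul, trace_smul, mul_vecMulVec, trace_vecMulVec, dotProduct_comm, smul_eq_mul]

/-- Spectral projections of a Hermitian matrix, together with the integrality of their trace. -/
theorem exists_spectralProjection {Y : Matrix (Fin (m + 1)) (Fin (m + 1)) ℂ} (hY : Y.IsHermitian)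
    (μ : ℝ) : ∃ (Q : Matrix (Fin (m + 1)) (Fin (m + 1)) ℂ) (d : ℕ), Q.trace = d ∧
      Y * Q = (μ : ℂ) • Q ∧ Q * Y = (μ : ℂ) • Q ∧
      (∀ B : Matrix (Fin (m + 1)) (Fin (m + 1)) ℂ, Y * B = (μ : ℂ) • B → Q * B = B) ∧
      d ≤ m + 1 ∧ (d = 0 → Q = 0) ∧ (d = m + 1 → Q = 1) := by
  classical
  set U : Matrix (Fin (m + 1)) (Fin (m + 1)) ℂ := ↑hY.eigenvectorUnitary with hU
  set l : Fin (m + 1) → ℂ := fun a => (hY.eigenvalues a : ℂ) with hl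
  have hUU : star U * U = 1 := Matrix.mem_unitaryGroup_iff'.1 hY.eigenvectorUnitary.2
  have hUU' : U * star U = 1 := Matrix.mem_unitaryGroup_iff.1 hY.eigenvectorUnitary.2
  have hspec : Y = U * diagonal l * star U := by
    have := hY.spectral_theorem
    rw [Unitary.conjStarAlgAut_apply] at this
    exact this
  set S : Finset (Fin (m + 1)) := Finset.univ.filter fun a => l a = μ with hS
  set χ : Fin (m + 1) → ℂ := fun a => if l a = μ then 1 else 0 with hχ
  have hmul : ∀ A B : Matrix (Fin (m + 1)) (Fin (m + 1)) ℂ,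
      (U * A * star U) * (U * B * star U) = U * (A * B) * star U := by
    intro A B
    calc _ = U * A * (star U * U) * B * star U := by simp only [mul_assoc]
      _ = _ := by rw [hUU]; simp only [mul_assoc, one_mul]
  refine ⟨U * diagonal χ * star U, S.card, ?_, ?_, ?_, ?_, ?_, ?_, ?_⟩
  · rw [mul_assoc, trace_mul_comm, mul_assoc, hUU, mul_one, trace_diagonal]
    simp [hχ, hS]
  · rw [hspec, hmul, diagonal_mul_diagonal, ← Matrix.smul_mul, ← Matrix.mul_smul,
      ← diagonal_smul]
    congr 3
    funext a
    by_cases h : l a = μ <;> simp [hχ, h]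
  · rw [hspec, hmul, diagonal_mul_diagonal, ← Matrix.smul_mul, ← Matrix.mul_smul,
      ← diagonal_smul]
    congr 3
    funext a
    by_cases h : l a = μ <;> simp [hχ, h]
  · intro B hB
    have h1 : diagonal l * (star U * B) = (μ : ℂ) • (star U * B) := by
      rw [← Matrix.mul_smul, ← hB, hspec]
      calc _ = (star U * U) * diagonal l * (star U * B) := by rw [hUU, one_mul]
        _ = _ := by simp only [mul_assoc]
    have h2 : diagonal χ * (star U * B) = star U * B := by
      ext a b
      have h3 := congrFun (congrFun h1 a) b
      rw [diagonal_mul, Matrix.smul_apply, smul_eq_mul] at h3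
      rw [diagonal_mul]
      by_cases h : l a = μ
      · simp [hχ, h]
      · have : (star U * B) a b = 0 := by
          have h4 : (l a - μ) * (star U * B) a b = 0 := by rw [sub_mul, h3, sub_self]
          exact (mul_eq_zero.1 h4).resolve_left (sub_ne_zero.2 h)
        rw [this, mul_zero]
    rw [mul_assoc, mul_assoc, h2, ← mul_assoc, hUU', one_mul]
  · simpa using Finset.card_le_univ S
  · intro h
    have : χ = 0 := by
      funext a
      have : a ∉ S := by rw [Finset.card_eq_zero.1 h]; simp
      simpa [hχ, hS] using this
    simp [this]
  · intro h
    have hS' : S = Finset.univ := by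
      rw [← Finset.card_eq_iff_eq_univ]; simpa using h
    have : χ = fun _ => 1 := by
      funext a
      have : a ∈ S := by rw [hS']; simp
      simpa [hχ, hS] using this
    rw [this, diagonal_one, mul_one, hUU']

/-- The equation `X h + k X = 0` with positive definite `h` and `k` has no nonzero solution. -/
theorem eq_zero_of_mul_add_mul_eq_zero {h k X : Matrix (Fin (m + 1)) (Fin (m + 1)) ℂ}
    (hh : h.PosDef) (hk : k.PosDef) (hX : X * h + k * X = 0) : X = 0 := by
  have h1 : (Xᴴ * k * X).PosSemidef := hk.posSemidef.conjTranspose_mul_mul_same X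
  have h2 : (X * h * Xᴴ).PosSemidef := hh.posSemidef.mul_mul_conjTranspose_same X
  have h3 : (X * h * Xᴴ).trace + (Xᴴ * k * X).trace = 0 := by
    have : (Xᴴ * (X * h + k * X)).trace = 0 := by rw [hX]; simp
    rw [mul_add, trace_add, trace_mul_comm, ← mul_assoc Xᴴ k X] at this
    exact this
  have h4 : (Xᴴ * k * X).trace = 0 :=
    ((add_eq_zero_iff_of_nonneg h2.trace_nonneg h1.trace_nonneg).1 h3).2
  have h5 : Xᴴ * k * X = 0 := h1.trace_eq_zero_iff.1 h4
  ext i j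
  by_contra hne
  have hv : X *ᵥ Pi.single j 1 ≠ 0 := fun h0 => hne (by simpa using congrFun h0 i)
  have h6 := hk.dotProduct_mulVec_pos hv
  have h7 : star (X *ᵥ Pi.single j 1) ⬝ᵥ k *ᵥ (X *ᵥ Pi.single j 1) =
      star (Pi.single j 1) ⬝ᵥ (Xᴴ * k * X) *ᵥ Pi.single j 1 := by
    rw [star_mulVec, ← dotProduct_mulVec, mulVec_mulVec, mulVec_mulVec, mul_assoc]
  rw [h7, h5] at h6
  simp at h6

/-- Positive definite square roots are unique. -/
theorem eq_of_mul_self_eq_mul_self {g h : Matrix (Fin (m + 1)) (Fin (m + 1)) ℂ} (hg : g.PosDef)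
    (hh : h.PosDef) (heq : g * g = h * h) : g = h := by
  refine sub_eq_zero.1 (eq_zero_of_mul_add_mul_eq_zero hg hh ?_)
  rw [sub_mul, mul_sub, heq]
  abel

/-! ### Edges -/

theorem edge_isHermitian {r : ℝ} {E : Matrix (Fin (m + 1)) (Fin (m + 1)) ℂ}
    (hE : E ∈ edgeOrbit m r) : E.IsHermitian := by
  obtain ⟨w, -, rfl⟩ := hE
  rw [IsHermitian, conjTranspose_smul, conjTranspose_vecMulVec]
  simp

theorem trace_edge {r : ℝ} {E : Matrix (Fin (m + 1)) (Fin (m + 1)) ℂ}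
    (hE : E ∈ edgeOrbit m r) : E.trace = r := by
  obtain ⟨w, hw, rfl⟩ := hE
  rw [trace_smul, trace_vecMulVec, dotProduct_comm, hw, smul_eq_mul, mul_one]

/-- An edge has rank one: `E A E` is a multiple of `E`. -/
theorem edge_mul_mul_edge {r : ℝ} {E : Matrix (Fin (m + 1)) (Fin (m + 1)) ℂ}
    (hE : E ∈ edgeOrbit m r) (A : Matrix (Fin (m + 1)) (Fin (m + 1)) ℂ) :
    E * A * E = (A * E).trace • E := by
  obtain ⟨w, hw, rfl⟩ := hE
  rw [trace_mul_smul_vecMulVec, mul_assoc, Matrix.mul_smul, mul_vecMulVec, Matrix.smul_mul,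
    Matrix.mul_smul, vecMulVec_mul_vecMulVec, vecMulVec_smul, smul_smul, smul_smul, smul_smul]
  congr 1
  ring

theorem trace_mul_conj_edge_nonneg {r : ℝ} (hr : 0 ≤ r) {E : Matrix (Fin (m + 1)) (Fin (m + 1)) ℂ}
    (hE : E ∈ edgeOrbit m r) {K : Matrix (Fin (m + 1)) (Fin (m + 1)) ℂ} (hK : K.PosSemidef)
    (X : Matrix (Fin (m + 1)) (Fin (m + 1)) ℂ) : 0 ≤ (K * (X * E * Xᴴ)).trace := by
  obtain ⟨w, hw, rfl⟩ := hE
  rw [Matrix.mul_smul, Matrix.smul_mul, mul_vecMulVec, vecMulVec_mul, ← star_mulVec,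
    trace_mul_smul_vecMulVec]
  exact mul_nonneg (by exact_mod_cast hr) (hK.dotProduct_mulVec_nonneg _)

theorem mul_edge_eq_zero_of_trace {r : ℝ} (hr : 0 < r)
    {E : Matrix (Fin (m + 1)) (Fin (m + 1)) ℂ}
    (hE : E ∈ edgeOrbit m r) {K : Matrix (Fin (m + 1)) (Fin (m + 1)) ℂ} (hK : K.PosDef)
    {X : Matrix (Fin (m + 1)) (Fin (m + 1)) ℂ} (h0 : (K * (X * E * Xᴴ)).trace = 0) :
    X * E = 0 := by
  obtain ⟨w, hw, rfl⟩ := hE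
  rw [Matrix.mul_smul, Matrix.smul_mul, mul_vecMulVec, vecMulVec_mul, ← star_mulVec,
    trace_mul_smul_vecMulVec] at h0
  have h1 := (mul_eq_zero.1 h0).resolve_left (by exact_mod_cast hr.ne')
  have h2 : X *ᵥ w = 0 := by
    by_contra hne
    exact (hK.dotProduct_mulVec_pos hne).ne' h1
  rw [Matrix.mul_smul, mul_vecMulVec, h2]
  simp

theorem trace_conj_edge_nonneg {r : ℝ} (hr : 0 ≤ r) {E : Matrix (Fin (m + 1)) (Fin (m + 1)) ℂ}
    (hE : E ∈ edgeOrbit m r) (X : Matrix (Fin (m + 1)) (Fin (m + 1)) ℂ) :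
    0 ≤ (X * E * Xᴴ).trace := by
  simpa using trace_mul_conj_edge_nonneg hr hE PosSemidef.one X

theorem edge_ne_zero {r : ℝ} (hr : 0 < r) {E : Matrix (Fin (m + 1)) (Fin (m + 1)) ℂ}
    (hE : E ∈ edgeOrbit m r) : E ≠ 0 := by
  rintro rfl
  have := trace_edge hE
  rw [trace_zero] at this
  exact hr.ne (by exact_mod_cast this)

theorem mul_edge_ne_zero {r : ℝ} (hr : 0 < r) {E : Matrix (Fin (m + 1)) (Fin (m + 1)) ℂ}
    (hE : E ∈ edgeOrbit m r) {X : Matrix (Fin (m + 1)) (Fin (m + 1)) ℂ} (hX : IsUnit X) :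
    X * E ≠ 0 := fun h => edge_ne_zero hr hE (hX.mul_right_eq_zero.1 h)

theorem trace_conj_edge_pos {r : ℝ} (hr : 0 < r) {E : Matrix (Fin (m + 1)) (Fin (m + 1)) ℂ}
    (hE : E ∈ edgeOrbit m r) {X : Matrix (Fin (m + 1)) (Fin (m + 1)) ℂ} (hX : X * E ≠ 0) :
    0 < (X * E * Xᴴ).trace := by
  refine lt_of_le_of_ne (trace_conj_edge_nonneg hr.le hE X) fun h => hX ?_
  refine mul_edge_eq_zero_of_trace hr hE (K := 1) PosDef.one ?_
  rw [one_mul, ← h]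

/-- A nonzero matrix `X E X*` is, after a change of length, again an edge. -/
theorem normalized_conj_mem_edgeOrbit {r : ℝ} (hr : 0 < r)
    {E : Matrix (Fin (m + 1)) (Fin (m + 1)) ℂ}
    (hE : E ∈ edgeOrbit m r) {X : Matrix (Fin (m + 1)) (Fin (m + 1)) ℂ} (hX : X * E ≠ 0) (s : ℝ) :
    ((s : ℂ) * (X * E * Xᴴ).trace⁻¹) • (X * E * Xᴴ) ∈ edgeOrbit m s := by
  have hpos := trace_conj_edge_pos hr hE hX
  obtain ⟨w, hw, rfl⟩ := hE
  rw [Matrix.mul_smul, Matrix.smul_mul, mul_vecMulVec, vecMulVec_mul, ← star_mulVec] at hpos ⊢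
  set v := X *ᵥ w
  rw [trace_smul, trace_vecMulVec, dotProduct_comm, smul_eq_mul] at hpos ⊢
  have hrc : (0 : ℂ) < r := by exact_mod_cast hr
  have hv : 0 < star v ⬝ᵥ v := pos_of_mul_pos_right hpos hrc.le
  obtain ⟨a, ha, hav⟩ : ∃ a : ℝ, 0 < a ∧ ((a : ℂ)) = star v ⬝ᵥ v := by
    refine ⟨(star v ⬝ᵥ v).re, (Complex.pos_iff.1 hv).1, ?_⟩
    exact Complex.ext rfl (Complex.pos_iff.1 hv).2
  have hs : ((Real.sqrt a : ℝ) : ℂ) * (Real.sqrt a : ℝ) = a := by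
    exact_mod_cast Real.mul_self_sqrt ha.le
  have hs0 : ((Real.sqrt a : ℝ) : ℂ) ≠ 0 := by
    exact_mod_cast (Real.sqrt_pos.2 ha).ne'
  have ha0 : (a : ℂ) ≠ 0 := by exact_mod_cast ha.ne'
  have hst : star (((Real.sqrt a : ℝ) : ℂ)⁻¹) = (((Real.sqrt a : ℝ) : ℂ)⁻¹) := by simp
  refine ⟨((Real.sqrt a : ℝ) : ℂ)⁻¹ • v, ?_, ?_⟩
  · rw [star_smul, smul_dotProduct, dotProduct_smul, ← hav, hst, smul_eq_mul, smul_eq_mul,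
      ← mul_assoc, ← mul_inv, hs, inv_mul_cancel₀ ha0]
  · rw [star_smul, smul_vecMulVec, vecMulVec_smul, smul_smul, smul_smul, smul_smul, hst, ← hav]
    congr 1
    rw [mul_assoc (s : ℂ) (_⁻¹) (_⁻¹), ← mul_inv (Real.sqrt a : ℂ), hs]
    have := hrc.ne'
    field_simp

/-! ### Polygons with side lengths off the walls -/

/-- The number `Λ` for which the edges of a closed polygon with side lengths `r` add up
to `Λ I`. -/
def meanLength (m : ℕ) (r : Fin n → ℝ) : ℝ := (∑ i, r i) / ((m : ℝ) + 1)

theorem sum_closedPolygon {r : Fin n → ℝ} {e : Tuple n m} (he : e ∈ closedPolygons m r) :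
    ∑ i, e i = (meanLength m r : ℂ) • (1 : Matrix (Fin (m + 1)) (Fin (m + 1)) ℂ) := he.2

theorem meanLength_mul (m : ℕ) (r : Fin n → ℝ) : meanLength m r * ((m : ℝ) + 1) = ∑ i, r i := by
  unfold meanLength
  have : (m : ℝ) + 1 ≠ 0 := by positivity
  field_simp

theorem meanLength_pos (hn : 0 < n) {r : Fin n → ℝ} (hr : ∀ i, 0 < r i) : 0 < meanLength m r := by
  have : Nonempty (Fin n) := ⟨⟨0, hn⟩⟩
  exact div_pos (Finset.sum_pos (fun i _ => hr i) Finset.univ_nonempty) (by positivity)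

theorem sum_trace_mul_closedPolygon {r : Fin n → ℝ} {e : Tuple n m} (he : e ∈ closedPolygons m r)
    (A : Matrix (Fin (m + 1)) (Fin (m + 1)) ℂ) :
    ∑ i, (A * e i).trace = meanLength m r * A.trace := by
  rw [← trace_sum, ← Finset.mul_sum, sum_closedPolygon he, Matrix.mul_smul, mul_one, trace_smul,
    smul_eq_mul]

/-- Off the walls, no group of edges has the total length that the edges in a subspace of
dimension `d`, forming a closed polygon there, would have. -/
theorem sum_ne_of_not_mem_wallUnion (hn : 0 < n) {r : Fin n → ℝ} (hr : r ∈ cone n m)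
    (hw : r ∉ wallUnion n m) (I : Finset (Fin n)) {d : ℕ} (h0 : d ≠ 0) (h1 : d ≤ m + 1)
    (h2 : d ≠ m + 1) : ∑ i ∈ I, r i ≠ meanLength m r * d := by
  intro h
  have hL : 0 < meanLength m r := meanLength_pos hn hr.1
  have hd : (0 : ℝ) < d := by positivity
  have hdm : (d : ℝ) < m + 1 := by exact_mod_cast lt_of_le_of_ne h1 h2
  have hsum : ∑ i ∈ I, r i + ∑ j ∈ Iᶜ, r j = meanLength m r * ((m : ℝ) + 1) := by
    rw [Finset.sum_add_sum_compl, meanLength_mul]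
  refine hw ⟨I, Iᶜ, m + 1 - d, ⟨disjoint_compl_right, Finset.union_compl I, ?_, ?_⟩, by omega,
    by omega, ⟨⟨hr.1, ?_⟩, hr⟩⟩
  · rw [Finset.nonempty_iff_ne_empty]
    rintro rfl
    rw [Finset.sum_empty] at h
    exact (mul_pos hL hd).ne h
  · rw [Finset.nonempty_iff_ne_empty]
    intro hJ
    rw [hJ, Finset.sum_empty, add_zero, h] at hsum
    exact hdm.ne (mul_left_cancel₀ hL.ne' hsum)
  · have : ((m + 1 - d : ℕ) : ℝ) = m + 1 - d := by
      rw [Nat.cast_sub h1]; push_cast; ring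
    rw [this, eq_sub_of_add_eq' hsum, h]
    ring

/-- Off the walls, the common eigenspaces of the edges are trivial: a Hermitian matrix of which the
edges are eigenvectors is a scalar. Otherwise the edges in one of its eigenspaces would form a
closed polygon there. -/
theorem eq_smul_one_of_mul_edge (hn : 0 < n) {r : Fin n → ℝ} (hr : r ∈ cone n m)
    (hw : r ∉ wallUnion n m) {e : Tuple n m} (he : e ∈ closedPolygons m r)
    {Y : Matrix (Fin (m + 1)) (Fin (m + 1)) ℂ} (hY : Y.IsHermitian) (ν : Fin n → ℝ)
    (hν : ∀ i, Y * e i = (ν i : ℂ) • e i) : ∃ μ : ℝ, Y = (μ : ℂ) • 1 := by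
  classical
  -- the eigenvalue of an edge, so that its eigenspace is not zero
  obtain ⟨Q, d, htr, hYQ, hQY, hQ, hd, hd0, hd1⟩ := exists_spectralProjection hY (ν ⟨0, hn⟩)
  set μ := ν ⟨0, hn⟩
  have hd0' : d ≠ 0 := by
    intro h
    have := hQ (e ⟨0, hn⟩) (hν _)
    rw [hd0 h, zero_mul] at this
    exact edge_ne_zero (hr.1 _) (he.1 _) this.symm
  by_cases hd1' : d = m + 1
  · refine ⟨μ, ?_⟩
    rw [hd1 hd1', mul_one] at hYQ
    exact hYQ
  exfalso
  have h1 : ∀ i, (Q * e i).trace = if ν i = μ then (r i : ℂ) else 0 := by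
    intro i
    split_ifs with h
    · rw [hQ _ (by rw [hν, h]), trace_edge (he.1 i)]
    · have h2 : (ν i : ℂ) • (Q * e i) = (μ : ℂ) • (Q * e i) := by
        rw [← Matrix.mul_smul, ← hν, ← mul_assoc, hQY, Matrix.smul_mul]
      have h3 : ((ν i : ℂ) - μ) • (Q * e i) = 0 := by rw [sub_smul, h2, sub_self]
      have h4 : ((ν i : ℂ) - μ) ≠ 0 := sub_ne_zero.2 (by exact_mod_cast h)
      rw [(smul_eq_zero.1 h3).resolve_left h4, trace_zero]
  have h2 := sum_trace_mul_closedPolygon he Q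
  simp only [h1, htr] at h2
  rw [← Finset.sum_filter] at h2
  exact sum_ne_of_not_mem_wallUnion hn hr hw _ hd0' hd hd1' (by exact_mod_cast h2)

/-- The infinitesimal form of the rigidity of polygons off the walls. For Hermitian `Z` the equation
says that moving the lines spanned by the edges by `1 + t Z`, with fixed side lengths, preserves the
closing condition to first order. -/
theorem eq_smul_one_of_smul_eq_sum (hn : 0 < n) {r : Fin n → ℝ} (hr : r ∈ cone n m)
    (hw : r ∉ wallUnion n m) {e : Tuple n m} (he : e ∈ closedPolygons m r)
    {Z : Matrix (Fin (m + 1)) (Fin (m + 1)) ℂ}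
    (hZ : (meanLength m r : ℂ) • Z = ∑ i, ((r i : ℂ)⁻¹ * (Z * e i).trace) • e i) :
    ∃ c : ℂ, Z = c • 1 := by
  -- the Hermitian case: the sum of the nonnegative traces of `(Z - zᵢ) eᵢ (Z - zᵢ)` vanishes
  have key : ∀ Y : Matrix (Fin (m + 1)) (Fin (m + 1)) ℂ, Y.IsHermitian →
      (meanLength m r : ℂ) • Y = ∑ i, ((r i : ℂ)⁻¹ * (Y * e i).trace) • e i →
      ∃ μ : ℝ, Y = (μ : ℂ) • 1 := by
    intro Y hY hYe
    have hreal : ∀ i, ∃ z : ℝ, (Y * e i).trace = r i * z := by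
      intro i
      have h1 : star (Y * e i).trace = (Y * e i).trace := by
        rw [← trace_conjTranspose, conjTranspose_mul, hY, edge_isHermitian (he.1 i),
          trace_mul_comm]
      obtain ⟨z, hz⟩ := Complex.conj_eq_iff_real.1 h1
      refine ⟨z / r i, ?_⟩
      have : (r i : ℂ) ≠ 0 := by exact_mod_cast (hr.1 i).ne'
      rw [hz]; push_cast; field_simp
    choose z hz using hreal
    have hherm : ∀ i, (Y - (z i : ℂ) • 1)ᴴ = Y - (z i : ℂ) • 1 := by
      intro i
      rw [conjTranspose_sub, hY, conjTranspose_smul, conjTranspose_one]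
      simp
    have hexp : ∀ i, ((Y - (z i : ℂ) • 1) * e i * (Y - (z i : ℂ) • 1)ᴴ).trace =
        (Y * Y * e i).trace - (r i : ℂ)⁻¹ * (Y * e i).trace * (Y * e i).trace := by
      intro i
      have hri : (r i : ℂ) ≠ 0 := by exact_mod_cast (hr.1 i).ne'
      rw [hherm, trace_mul_cycle, trace_mul_comm]
      simp only [mul_sub, sub_mul, Matrix.mul_smul, Matrix.smul_mul, mul_one, one_mul, trace_sub,
        trace_smul, smul_eq_mul]
      rw [trace_mul_comm (e i) (Y * Y), trace_mul_comm (e i) Y, trace_edge (he.1 i), hz]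
      field_simp
      ring
    have hsum : ∑ i, ((Y - (z i : ℂ) • 1) * e i * (Y - (z i : ℂ) • 1)ᴴ).trace = 0 := by
      simp only [hexp]
      rw [Finset.sum_sub_distrib, sum_trace_mul_closedPolygon he]
      have h2 : (Y * ((meanLength m r : ℂ) • Y)).trace =
          ∑ i, (r i : ℂ)⁻¹ * (Y * e i).trace * (Y * e i).trace := by
        rw [hYe, Finset.mul_sum, trace_sum]
        simp only [Matrix.mul_smul, trace_smul, smul_eq_mul]
      rw [← h2, Matrix.mul_smul, trace_smul, smul_eq_mul, sub_self]
    have hzero := (Finset.sum_eq_zero_iff_of_nonneg fun i _ =>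
      trace_conj_edge_nonneg (hr.1 i).le (he.1 i) (Y - (z i : ℂ) • 1)).1 hsum
    refine eq_smul_one_of_mul_edge hn hr hw he hY z fun i => ?_
    have h3 := mul_edge_eq_zero_of_trace (hr.1 i) (he.1 i) (K := 1) PosDef.one
      (by rw [one_mul]; exact hzero i (Finset.mem_univ i))
    rw [sub_mul, Matrix.smul_mul, one_mul] at h3
    exact sub_eq_zero.1 h3
  have hZ' : (meanLength m r : ℂ) • Zᴴ = ∑ i, ((r i : ℂ)⁻¹ * (Zᴴ * e i).trace) • e i := by
    have h1 := congrArg conjTranspose hZ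
    rw [conjTranspose_smul, conjTranspose_sum] at h1
    simp only [conjTranspose_smul, star_mul', star_inv₀, Complex.star_def, Complex.conj_ofReal]
      at h1
    rw [h1]
    refine Finset.sum_congr rfl fun i _ => ?_
    rw [edge_isHermitian (he.1 i), ← Complex.star_def, ← trace_conjTranspose, conjTranspose_mul,
      edge_isHermitian (he.1 i), trace_mul_comm]
  obtain ⟨a, ha⟩ := key (Z + Zᴴ) (isHermitian_add_transpose_self Z) (by
    rw [smul_add, hZ, hZ', ← Finset.sum_add_distrib]
    exact Finset.sum_congr rfl fun i _ => by
      rw [add_mul Z, trace_add, mul_add, add_smul])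
  obtain ⟨b, hb⟩ := key (Complex.I • (Z - Zᴴ))
    (by
      rw [IsHermitian, conjTranspose_smul, conjTranspose_sub, conjTranspose_conjTranspose,
        Complex.star_def, Complex.conj_I, neg_smul, ← smul_neg, neg_sub])
    (by
      rw [smul_comm, smul_sub, hZ, hZ', ← Finset.sum_sub_distrib, Finset.smul_sum]
      exact Finset.sum_congr rfl fun i _ => by
        rw [Matrix.smul_mul, trace_smul, sub_mul Z, trace_sub, ← sub_smul, smul_smul, smul_eq_mul]
        congr 1
        ring)
  refine ⟨((a : ℂ) - Complex.I * b) / 2, ?_⟩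
  have h1 : Z - Zᴴ = -(Complex.I * b) • (1 : Matrix (Fin (m + 1)) (Fin (m + 1)) ℂ) := by
    rw [neg_smul, mul_smul, ← hb, smul_smul, Complex.I_mul_I, neg_smul, one_smul, neg_neg]
  have h2 : (2 : ℂ) • Z = ((a : ℂ) - Complex.I * b) • 1 := by
    rw [sub_eq_add_neg, add_smul, ← ha, ← h1, two_smul]
    abel
  rw [div_eq_inv_mul, mul_smul, ← h2, smul_smul]
  norm_num

/-- The global form of the rigidity of polygons off the walls. Comparing the traces of the two
closing conditions gives equality in the Cauchy-Schwarz inequality for every edge. -/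
theorem eq_smul_one_of_sum_eq_smul_inv (hn : 0 < n) {r : Fin n → ℝ} (hr : r ∈ cone n m)
    (hw : r ∉ wallUnion n m) {e : Tuple n m} (he : e ∈ closedPolygons m r)
    {H K : Matrix (Fin (m + 1)) (Fin (m + 1)) ℂ} (hH : H.PosDef) (hK : K.PosDef) (hHK : H * K = 1)
    (hsum : ∑ i, ((r i : ℂ) * ((H * e i).trace)⁻¹) • e i = (meanLength m r : ℂ) • K) :
    ∃ μ : ℝ, H = (μ : ℂ) • 1 := by
  have hKH : K * H = 1 := mul_eq_one_comm.1 hHK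
  have hreal : ∀ i, ∃ z : ℝ, z ≠ 0 ∧ (H * e i).trace = r i * z := by
    intro i
    have h1 : star (H * e i).trace = (H * e i).trace := by
      rw [← trace_conjTranspose, conjTranspose_mul, hH.1, edge_isHermitian (he.1 i),
        trace_mul_comm]
    have h0 : (H * e i).trace ≠ 0 := by
      intro h0
      have := mul_edge_eq_zero_of_trace (hr.1 i) (he.1 i) hH (X := 1) (by simpa using h0)
      rw [one_mul] at this
      exact edge_ne_zero (hr.1 i) (he.1 i) this
    obtain ⟨z, hz⟩ := Complex.conj_eq_iff_real.1 h1
    have hri : (r i : ℂ) ≠ 0 := by exact_mod_cast (hr.1 i).ne'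
    refine ⟨z / r i, div_ne_zero (fun hz0 => h0 (by rw [hz, hz0]; simp)) (hr.1 i).ne', ?_⟩
    rw [hz]; push_cast; field_simp
  choose z hz0 hz using hreal
  have hherm : ∀ i, (H - (z i : ℂ) • 1)ᴴ = H - (z i : ℂ) • 1 := by
    intro i
    rw [conjTranspose_sub, hH.1, conjTranspose_smul, conjTranspose_one]
    simp
  have hexp : ∀ i, ((z i : ℂ) ^ 2)⁻¹ *
      (K * ((H - (z i : ℂ) • 1) * e i * (H - (z i : ℂ) • 1)ᴴ)).trace =
      (K * e i).trace - ((r i : ℂ) * ((H * e i).trace)⁻¹) * (e i).trace := by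
    intro i
    have hri : (r i : ℂ) ≠ 0 := by exact_mod_cast (hr.1 i).ne'
    have hzi : (z i : ℂ) ≠ 0 := by exact_mod_cast hz0 i
    have h1 : K * ((H - (z i : ℂ) • 1) * e i * (H - (z i : ℂ) • 1)ᴴ) =
        (e i - (z i : ℂ) • (K * e i)) * (H - (z i : ℂ) • 1) := by
      rw [hherm, ← mul_assoc, ← mul_assoc, mul_sub K, hKH, Matrix.mul_smul, mul_one, sub_mul 1,
        one_mul, Matrix.smul_mul]
    rw [h1, trace_mul_comm]
    simp only [mul_sub, sub_mul, Matrix.mul_smul, Matrix.smul_mul, one_mul, trace_sub,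
      trace_smul, smul_eq_mul]
    rw [← mul_assoc H K, hHK, one_mul, trace_edge (he.1 i), hz]
    field_simp
    ring
  have hzsq : ∀ i, (0 : ℂ) < ((z i : ℂ) ^ 2)⁻¹ := fun i => by
    have : 0 < (z i ^ 2)⁻¹ := by have := hz0 i; positivity
    exact_mod_cast this
  -- each summand is the defect `(tr (K eᵢ) tr (H eᵢ) - rᵢ²) / tr (H eᵢ)` in the Cauchy-Schwarz
  -- inequality
  have htot : ∑ i, ((z i : ℂ) ^ 2)⁻¹ *
      (K * ((H - (z i : ℂ) • 1) * e i * (H - (z i : ℂ) • 1)ᴴ)).trace = 0 := by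
    simp only [hexp]
    rw [Finset.sum_sub_distrib, sum_trace_mul_closedPolygon he]
    have := congrArg trace hsum
    rw [trace_sum, trace_smul, smul_eq_mul] at this
    simp only [trace_smul, smul_eq_mul] at this
    rw [this, sub_self]
  have hzero := (Finset.sum_eq_zero_iff_of_nonneg fun i _ => mul_nonneg (hzsq i).le
    (trace_mul_conj_edge_nonneg (hr.1 i).le (he.1 i) hK.posSemidef (H - (z i : ℂ) • 1))).1 htot
  refine eq_smul_one_of_mul_edge hn hr hw he hH.1 z fun i => ?_
  have h3 := mul_edge_eq_zero_of_trace (hr.1 i) (he.1 i) hK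
    ((mul_eq_zero.1 (hzero i (Finset.mem_univ i))).resolve_left (hzsq i).ne')
  rw [sub_mul, Matrix.smul_mul, one_mul] at h3
  exact sub_eq_zero.1 h3

/-! ### Transforming the edges of a polygon by a positive definite matrix -/

/-- The multiple of `M` with trace `s` (zero if `M` has trace zero). -/
def withTrace (s : ℂ) (M : Matrix (Fin (m + 1)) (Fin (m + 1)) ℂ) :
    Matrix (Fin (m + 1)) (Fin (m + 1)) ℂ := (s * M.trace⁻¹) • M

theorem withTrace_smul (s : ℂ) {a : ℂ} (ha : a ≠ 0) (M : Matrix (Fin (m + 1)) (Fin (m + 1)) ℂ) :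
    withTrace s (a • M) = withTrace s M := by
  unfold withTrace
  rw [trace_smul, smul_smul, smul_eq_mul, mul_inv, mul_assoc, mul_right_comm a⁻¹,
    inv_mul_cancel₀ ha, one_mul]

theorem withTrace_trace {M : Matrix (Fin (m + 1)) (Fin (m + 1)) ℂ} (hM : M.trace ≠ 0) :
    withTrace M.trace M = M := by
  rw [withTrace, mul_inv_cancel₀ hM, one_smul]

/-- The linkage with side lengths `r` whose `i`-th edge lies on the line `g w`, where `w` spans the
`i`-th edge of `e` (for a Hermitian matrix `g`). -/
def rescale (r : Fin n → ℝ) (g : Matrix (Fin (m + 1)) (Fin (m + 1)) ℂ) (e : Tuple n m) :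
    Tuple n m := fun i => withTrace (r i) (g * e i * g)

/-- The positive definite matrix `g` transforms the polygon `e` into a closed polygon with side
lengths `r`. -/
def Balances (r : Fin n → ℝ) (g : Matrix (Fin (m + 1)) (Fin (m + 1)) ℂ) (e : Tuple n m) : Prop :=
  g.PosDef ∧ rescale r g e ∈ closedPolygons m r

theorem trace_mul_edge_mul_ne_zero {s : ℝ} (hs : 0 < s) {E g : Matrix (Fin (m + 1)) (Fin (m + 1)) ℂ}
    (hE : E ∈ edgeOrbit m s) (hg : g.PosDef) : (g * E * g).trace ≠ 0 := by
  have := trace_conj_edge_pos hs hE (mul_edge_ne_zero hs hE hg.isUnit)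
  rw [hg.1] at this
  exact this.ne'

theorem rescale_mem_linkages {s : Fin n → ℝ} (hs : ∀ i, 0 < s i) {e : Tuple n m}
    (he : e ∈ linkages m s) {g : Matrix (Fin (m + 1)) (Fin (m + 1)) ℂ} (hg : g.PosDef)
    (r : Fin n → ℝ) : rescale r g e ∈ linkages m r := by
  intro i
  have := normalized_conj_mem_edgeOrbit (hs i) (he i) (mul_edge_ne_zero (hs i) (he i) hg.isUnit)
    (r i)
  rwa [hg.1] at this

theorem rescale_smul (r : Fin n → ℝ) {c : ℂ} (hc : c ≠ 0)
    (g : Matrix (Fin (m + 1)) (Fin (m + 1)) ℂ) (e : Tuple n m) :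
    rescale r (c • g) e = rescale r g e := by
  funext i
  rw [rescale, rescale, Matrix.smul_mul, Matrix.smul_mul, Matrix.mul_smul, withTrace_smul _ hc,
    withTrace_smul _ hc]

theorem rescale_rescale {s : Fin n → ℝ} (hs : ∀ i, 0 < s i) {e : Tuple n m}
    (he : e ∈ linkages m s) {g : Matrix (Fin (m + 1)) (Fin (m + 1)) ℂ} (hg : g.PosDef)
    {r : Fin n → ℝ} (hr : ∀ i, 0 < r i) (t : Fin n → ℝ)
    (h : Matrix (Fin (m + 1)) (Fin (m + 1)) ℂ) (i : Fin n) :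
    rescale t h (rescale r g e) i = withTrace (t i) ((h * g) * e i * (g * h)) := by
  have h1 := trace_mul_edge_mul_ne_zero (hs i) (he i) hg
  have h2 : (r i : ℂ) ≠ 0 := by exact_mod_cast (hr i).ne'
  rw [rescale, rescale]
  nth_rewrite 2 [withTrace]
  rw [Matrix.mul_smul, Matrix.smul_mul, withTrace_smul _ (mul_ne_zero h2 (inv_ne_zero h1))]
  simp only [mul_assoc]

theorem withTrace_edge {s : ℝ} (hs : 0 < s) {E : Matrix (Fin (m + 1)) (Fin (m + 1)) ℂ}
    (hE : E ∈ edgeOrbit m s) : withTrace s E = E := by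
  rw [← trace_edge hE]
  refine withTrace_trace ?_
  rw [trace_edge hE]
  exact_mod_cast hs.ne'

theorem rescale_one {s : Fin n → ℝ} (hs : ∀ i, 0 < s i) {e : Tuple n m}
    (he : e ∈ linkages m s) : rescale s 1 e = e := by
  funext i
  rw [rescale, one_mul, mul_one, withTrace_edge (hs i) (he i)]

theorem posDef_mul_inv {g : Matrix (Fin (m + 1)) (Fin (m + 1)) ℂ} (hg : g.PosDef) :
    g * g⁻¹ = 1 := Matrix.mul_nonsing_inv _ ((Matrix.isUnit_iff_isUnit_det _).1 hg.isUnit)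

theorem posDef_inv_mul {g : Matrix (Fin (m + 1)) (Fin (m + 1)) ℂ} (hg : g.PosDef) :
    g⁻¹ * g = 1 := Matrix.nonsing_inv_mul _ ((Matrix.isUnit_iff_isUnit_det _).1 hg.isUnit)

theorem rescale_inv_rescale {s : Fin n → ℝ} (hs : ∀ i, 0 < s i) {e : Tuple n m}
    (he : e ∈ linkages m s) {g : Matrix (Fin (m + 1)) (Fin (m + 1)) ℂ} (hg : g.PosDef)
    {r : Fin n → ℝ} (hr : ∀ i, 0 < r i) : rescale s g⁻¹ (rescale r g e) = e := by
  funext i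
  rw [rescale_rescale hs he hg hr, posDef_inv_mul hg, posDef_mul_inv hg, one_mul, mul_one,
    withTrace_edge (hs i) (he i)]

theorem rescale_conj (r : Fin n → ℝ) {u : Matrix (Fin (m + 1)) (Fin (m + 1)) ℂ}
    (hu : u ∈ unitaryGroup (Fin (m + 1)) ℂ) (g : Matrix (Fin (m + 1)) (Fin (m + 1)) ℂ)
    (e : Tuple n m) (i : Fin n) :
    rescale r (u * g * star u) (fun i => u * e i * star u) i = u * rescale r g e i * star u := by
  have huu : star u * u = 1 := mem_unitaryGroup_iff'.1 hu
  have h1 : u * g * star u * (u * e i * star u) * (u * g * star u) =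
      u * (g * e i * g) * star u := by
    calc _ = u * g * (star u * u) * e i * (star u * u) * g * star u := by simp only [mul_assoc]
      _ = _ := by rw [huu]; simp only [mul_one, mul_assoc]
  have h2 : (u * (g * e i * g) * star u).trace = (g * e i * g).trace := by
    rw [trace_mul_comm, ← mul_assoc, huu, one_mul]
  rw [rescale, rescale, h1, withTrace, withTrace, h2, Matrix.mul_smul, Matrix.smul_mul]

theorem conj_mem_edgeOrbit {s : ℝ} {E u : Matrix (Fin (m + 1)) (Fin (m + 1)) ℂ}
    (hE : E ∈ edgeOrbit m s) (hu : u ∈ unitaryGroup (Fin (m + 1)) ℂ) :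
    u * E * star u ∈ edgeOrbit m s := by
  have huu : star u * u = 1 := mem_unitaryGroup_iff'.1 hu
  obtain ⟨w, hw, rfl⟩ := hE
  refine ⟨u *ᵥ w, ?_, ?_⟩
  · rw [star_mulVec, ← dotProduct_mulVec, mulVec_mulVec, ← star_eq_conjTranspose, huu, one_mulVec,
      hw]
  · rw [Matrix.mul_smul, Matrix.smul_mul, mul_vecMulVec, vecMulVec_mul, star_mulVec]
    rfl

theorem conj_mem_closedPolygons {r : Fin n → ℝ} {e : Tuple n m} (he : e ∈ closedPolygons m r)
    {u : Matrix (Fin (m + 1)) (Fin (m + 1)) ℂ} (hu : u ∈ unitaryGroup (Fin (m + 1)) ℂ) :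
    (fun i => u * e i * star u) ∈ closedPolygons m r := by
  refine ⟨fun i => conj_mem_edgeOrbit (he.1 i) hu, ?_⟩
  rw [← Finset.sum_mul, ← Finset.mul_sum, he.2, Matrix.mul_smul, Matrix.smul_mul, mul_one,
    mem_unitaryGroup_iff.1 hu]

theorem Balances.conj {r : Fin n → ℝ} {g : Matrix (Fin (m + 1)) (Fin (m + 1)) ℂ} {e : Tuple n m}
    (h : Balances r g e) {u : Matrix (Fin (m + 1)) (Fin (m + 1)) ℂ}
    (hu : u ∈ unitaryGroup (Fin (m + 1)) ℂ) :
    Balances r (u * g * star u) (fun i => u * e i * star u) := by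
  refine ⟨?_, ?_⟩
  · have huu : u * star u = 1 := mem_unitaryGroup_iff.1 hu
    have hunit : IsUnit u := IsUnit.of_mul_eq_one _ huu
    exact (Matrix.IsUnit.posDef_star_right_conjugate_iff hunit).2 h.1
  · have := conj_mem_closedPolygons h.2 hu
    convert this using 1
    funext i
    exact rescale_conj r hu g e i

/-- A polygon is transformed into at most one closed polygon with side lengths `r` off the
walls. -/
theorem Balances.rescale_eq (hn : 0 < n) {r : Fin n → ℝ} (hr : r ∈ cone n m)
    (hw : r ∉ wallUnion n m) {s : Fin n → ℝ} (hs : ∀ i, 0 < s i) {e : Tuple n m}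
    (he : e ∈ linkages m s) {g h : Matrix (Fin (m + 1)) (Fin (m + 1)) ℂ}
    (hg : Balances r g e) (hh : Balances r h e) : rescale r g e = rescale r h e := by
  have hgi := posDef_mul_inv hg.1
  have hig := posDef_inv_mul hg.1
  have hhi := posDef_mul_inv hh.1
  have hih := posDef_inv_mul hh.1
  -- `h g⁻¹` transforms the first balanced polygon into the second; `H` is its square modulus and
  -- `K` the inverse of `H`
  have hH : (g⁻¹ * (h * h) * g⁻¹).PosDef := by
    have h1 := (Matrix.IsUnit.posDef_star_right_conjugate_iff
      (U := g⁻¹ * h) (x := (1 : Matrix (Fin (m + 1)) (Fin (m + 1)) ℂ))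
      (hg.1.inv.isUnit.mul hh.1.isUnit)).2 PosDef.one
    rw [star_eq_conjTranspose, conjTranspose_mul, hh.1.1, hg.1.inv.1] at h1
    simpa only [mul_assoc, mul_one] using h1
  have hK : (g * (h⁻¹ * h⁻¹) * g).PosDef := by
    have h1 := (Matrix.IsUnit.posDef_star_right_conjugate_iff
      (U := g * h⁻¹) (x := (1 : Matrix (Fin (m + 1)) (Fin (m + 1)) ℂ))
      (hg.1.isUnit.mul hh.1.inv.isUnit)).2 PosDef.one
    rw [star_eq_conjTranspose, conjTranspose_mul, hg.1.1, hh.1.inv.1] at h1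
    simpa only [mul_assoc, mul_one] using h1
  have hHK : (g⁻¹ * (h * h) * g⁻¹) * (g * (h⁻¹ * h⁻¹) * g) = 1 := by
    calc _ = g⁻¹ * (h * (h * (g⁻¹ * g) * h⁻¹) * h⁻¹) * g := by simp only [mul_assoc]
      _ = 1 := by rw [hig, mul_one, hhi, mul_one, hhi, mul_one, hig]
  obtain ⟨μ, hμ⟩ := eq_smul_one_of_sum_eq_smul_inv hn hr hw hg.2 hH hK hHK (by
    have h1 : ∀ i, ((r i : ℂ) *
        ((g⁻¹ * (h * h) * g⁻¹ * rescale r g e i).trace)⁻¹) • rescale r g e i =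
        (g * h⁻¹) * rescale r h e i * (h⁻¹ * g) := by
      intro i
      have ht := trace_mul_edge_mul_ne_zero (hs i) (he i) hg.1
      have hri : (r i : ℂ) ≠ 0 := by exact_mod_cast (hr.1 i).ne'
      have h2 : (g⁻¹ * (h * h) * g⁻¹ * rescale r g e i).trace =
          ((r i : ℂ) * (g * e i * g).trace⁻¹) * (h * e i * h).trace := by
        rw [rescale, withTrace, Matrix.mul_smul, trace_smul, smul_eq_mul]
        congr 1
        calc _ = (g⁻¹ * (h * h * (g⁻¹ * g) * e i * g)).trace := by simp only [mul_assoc]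
          _ = (h * (h * e i)).trace := by
            rw [hig, mul_one, trace_mul_comm, mul_assoc, hgi, mul_one, mul_assoc]
          _ = _ := by rw [trace_mul_comm]
      have h3 : g * h⁻¹ * (h * e i * h) * (h⁻¹ * g) = g * e i * g := by
        calc _ = g * (h⁻¹ * h) * e i * (h * h⁻¹) * g := by simp only [mul_assoc]
          _ = _ := by rw [hih, hhi, mul_one, mul_one]
      rw [h2, rescale, rescale, withTrace, withTrace, Matrix.mul_smul, Matrix.smul_mul, h3,
        smul_smul]
      congr 1
      field_simp
    simp only [h1]
    rw [← Finset.sum_mul, ← Finset.mul_sum, sum_closedPolygon hh.2, Matrix.mul_smul,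
      Matrix.smul_mul, mul_one]
    simp only [mul_assoc])
  have hμ0 : 0 < μ := by
    have h1 := hH.diag_pos (i := 0)
    rw [hμ] at h1
    simpa using h1
  have hsq : h * h = (μ : ℂ) • (g * g) := by
    calc _ = (g * g⁻¹) * (h * h) * (g⁻¹ * g) := by rw [hgi, hig, one_mul, mul_one]
      _ = g * (g⁻¹ * (h * h) * g⁻¹) * g := by simp only [mul_assoc]
      _ = _ := by rw [hμ, Matrix.mul_smul, Matrix.smul_mul, mul_one]
  have hroot : ((Real.sqrt μ : ℝ) : ℂ) * (Real.sqrt μ : ℝ) = μ := by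
    exact_mod_cast Real.mul_self_sqrt hμ0.le
  have hpos : (0 : ℂ) < (Real.sqrt μ : ℝ) := by exact_mod_cast Real.sqrt_pos.2 hμ0
  have hfin : h = ((Real.sqrt μ : ℝ) : ℂ) • g := by
    refine eq_of_mul_self_eq_mul_self hh.1 (hg.1.smul hpos) ?_
    rw [hsq, Matrix.smul_mul, Matrix.mul_smul, smul_smul, hroot]
  rw [hfin, rescale_smul r hpos.ne']

/-! ### Smooth dependence of the balancing matrix -/

section MatrixCalculus

variable {E : Type*} [NormedAddCommGroup E] [NormedSpace ℝ E] {k : WithTop ℕ∞} {x : E}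

theorem contDiffAt_matrix_iff {f : E → Matrix (Fin (m + 1)) (Fin (m + 1)) ℂ} :
    ContDiffAt ℝ k f x ↔ ∀ a b, ContDiffAt ℝ k (fun y => f y a b) x :=
  contDiffAt_pi.trans (forall_congr' fun _ => contDiffAt_pi)

theorem contDiffAt_matrix_mul {f g : E → Matrix (Fin (m + 1)) (Fin (m + 1)) ℂ}
    (hf : ContDiffAt ℝ k f x) (hg : ContDiffAt ℝ k g x) :
    ContDiffAt ℝ k (fun y => f y * g y) x := by
  rw [contDiffAt_matrix_iff] at *
  intro a b
  simp only [Matrix.mul_apply]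
  exact ContDiffAt.sum fun c _ => (hf a c).mul (hg c b)

theorem contDiffAt_matrix_trace {f : E → Matrix (Fin (m + 1)) (Fin (m + 1)) ℂ}
    (hf : ContDiffAt ℝ k f x) : ContDiffAt ℝ k (fun y => (f y).trace) x := by
  rw [contDiffAt_matrix_iff] at hf
  simp only [Matrix.trace, Matrix.diag]
  exact ContDiffAt.sum fun c _ => hf c c

theorem contDiffAt_complex_ofReal {f : E → ℝ} (hf : ContDiffAt ℝ k f x) :
    ContDiffAt ℝ k (fun y => (f y : ℂ)) x :=
  Complex.ofRealCLM.contDiff.contDiffAt.comp x hf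

theorem contDiffAt_matrix_smul {c : E → ℂ} {f : E → Matrix (Fin (m + 1)) (Fin (m + 1)) ℂ}
    (hc : ContDiffAt ℝ k c x) (hf : ContDiffAt ℝ k f x) :
    ContDiffAt ℝ k (fun y => c y • f y) x := by
  rw [contDiffAt_matrix_iff] at *
  intro a b
  exact hc.mul (hf a b)

theorem contDiffAt_rescale {r : E → Fin n → ℝ} {g : E → Matrix (Fin (m + 1)) (Fin (m + 1)) ℂ}
    {e : E → Tuple n m} (hr : ContDiffAt ℝ k r x) (hg : ContDiffAt ℝ k g x)
    (he : ContDiffAt ℝ k e x) (h0 : ∀ i, (g x * e x i * g x).trace ≠ 0) :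
    ContDiffAt ℝ k (fun y => rescale (r y) (g y) (e y)) x := by
  rw [contDiffAt_pi]
  intro i
  have h1 := contDiffAt_matrix_mul (contDiffAt_matrix_mul hg (contDiffAt_pi.1 he i)) hg
  exact contDiffAt_matrix_smul ((contDiffAt_complex_ofReal (contDiffAt_pi.1 hr i)).mul
    ((contDiffAt_matrix_trace h1).inv (h0 i))) h1

end MatrixCalculus

/-- The equation for the balancing matrix `g`: the multiple of the identity that involves the trace
of `g` fixes the scale of `g`, on which `rescale r g e` does not depend. -/
def balancingMap (τ : ℝ) (z : ((Fin n → ℝ) × Tuple n m) × Matrix (Fin (m + 1)) (Fin (m + 1)) ℂ) :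
    Matrix (Fin (m + 1)) (Fin (m + 1)) ℂ :=
  ∑ i, rescale z.1.1 z.2 z.1.2 i - ((meanLength m z.1.1 : ℂ) + z.2.trace - τ) • 1

theorem contDiffAt_balancingMap (τ : ℝ) {k : WithTop ℕ∞}
    {z : ((Fin n → ℝ) × Tuple n m) × Matrix (Fin (m + 1)) (Fin (m + 1)) ℂ}
    (h0 : ∀ i, (z.2 * z.1.2 i * z.2).trace ≠ 0) : ContDiffAt ℝ k (balancingMap τ) z := by
  unfold balancingMap
  have hr : ContDiffAt ℝ k
      (fun z : ((Fin n → ℝ) × Tuple n m) × Matrix (Fin (m + 1)) (Fin (m + 1)) ℂ => z.1.1) z :=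
    contDiffAt_fst.fst
  have he : ContDiffAt ℝ k
      (fun z : ((Fin n → ℝ) × Tuple n m) × Matrix (Fin (m + 1)) (Fin (m + 1)) ℂ => z.1.2) z :=
    contDiffAt_fst.snd
  have hg : ContDiffAt ℝ k
      (fun z : ((Fin n → ℝ) × Tuple n m) × Matrix (Fin (m + 1)) (Fin (m + 1)) ℂ => z.2) z :=
    contDiffAt_snd
  refine (ContDiffAt.sum fun i _ => contDiffAt_pi.1 (contDiffAt_rescale hr hg he h0) i).sub
    (contDiffAt_matrix_smul ?_ contDiffAt_const)
  refine ((contDiffAt_complex_ofReal ?_).add (contDiffAt_matrix_trace hg)).sub contDiffAt_const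
  exact (ContDiffAt.sum fun i _ => contDiffAt_pi.1 hr i).div_const _

theorem hasDerivAt_withTrace_line (s : ℂ) {g E : Matrix (Fin (m + 1)) (Fin (m + 1)) ℂ}
    (h0 : (g * E * g).trace ≠ 0) (X : Matrix (Fin (m + 1)) (Fin (m + 1)) ℂ) :
    HasDerivAt (fun t : ℝ => withTrace s ((g + t • X) * E * (g + t • X)))
      ((s * (g * E * g).trace⁻¹) • (X * E * g + g * E * X) -
        (s * ((X * E * g + g * E * X).trace * ((g * E * g).trace ^ 2)⁻¹)) • (g * E * g)) 0 := by
  have hexp : ∀ t : ℝ, (g + t • X) * E * (g + t • X) =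
      g * E * g + (t • (X * E * g + g * E * X) + (t ^ 2) • (X * E * X)) := by
    intro t
    simp only [add_mul, mul_add, Matrix.smul_mul, Matrix.mul_smul, smul_add, smul_smul, pow_two]
    abel
  have h1 : HasDerivAt (fun t : ℝ => (g + t • X) * E * (g + t • X))
      (X * E * g + g * E * X) 0 := by
    simp only [hexp]
    have h2 := ((hasDerivAt_id (0 : ℝ)).smul_const (X * E * g + g * E * X)).fun_add
      ((hasDerivAt_pow 2 (0 : ℝ)).smul_const (X * E * X))
    exact (h2.const_add (g * E * g)).congr_deriv (by simp)
  have h2 : HasDerivAt (fun t : ℝ => ((g + t • X) * E * (g + t • X)).trace)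
      (X * E * g + g * E * X).trace 0 := by
    simp only [Matrix.trace, Matrix.diag]
    refine HasDerivAt.fun_sum fun a _ => ?_
    exact hasDerivAt_pi.1 (hasDerivAt_pi.1 h1 a) a
  have h00 : ((g + (0 : ℝ) • X) * E * (g + (0 : ℝ) • X)) = g * E * g := by simp
  have h3 := (h2.fun_inv (by rw [h00]; exact h0)).const_mul s
  unfold withTrace
  have h4 := h3.fun_smul h1
  rw [h00] at h4
  refine h4.congr_deriv ?_
  rw [neg_div, mul_neg, neg_smul, ← sub_eq_add_neg, div_eq_mul_inv]

/-- The derivative of the equation in the direction `X`, in terms of `X g⁻¹ + g⁻¹ X` and the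
balanced polygon. -/
theorem fderiv_balancingMap_apply (τ : ℝ) {r s : Fin n → ℝ} (hr : ∀ i, 0 < r i)
    (hs : ∀ i, 0 < s i) {e : Tuple n m} (he : e ∈ linkages m s)
    {g : Matrix (Fin (m + 1)) (Fin (m + 1)) ℂ} (hg : Balances r g e)
    (X : Matrix (Fin (m + 1)) (Fin (m + 1)) ℂ) :
    fderiv ℝ (balancingMap τ) ((r, e), g) (0, X) =
      (meanLength m r : ℂ) • (X * g⁻¹ + g⁻¹ * X) -
        ∑ i, ((r i : ℂ)⁻¹ * ((X * g⁻¹ + g⁻¹ * X) * rescale r g e i).trace) • rescale r g e i -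
        X.trace • 1 := by
  have h0 : ∀ i, (g * e i * g).trace ≠ 0 := fun i => trace_mul_edge_mul_ne_zero (hs i) (he i) hg.1
  have hgi := posDef_mul_inv hg.1
  have hig := posDef_inv_mul hg.1
  have hline : HasDerivAt (fun t : ℝ => (((r, e), g + t • X) :
      ((Fin n → ℝ) × Tuple n m) × Matrix (Fin (m + 1)) (Fin (m + 1)) ℂ)) (0, X) 0 := by
    refine (hasDerivAt_const _ _).prodMk ?_
    simpa using ((hasDerivAt_id (0 : ℝ)).smul_const X).const_add g
  have hd : DifferentiableAt ℝ (balancingMap τ) (((r, e), g + (0 : ℝ) • X) :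
      ((Fin n → ℝ) × Tuple n m) × Matrix (Fin (m + 1)) (Fin (m + 1)) ℂ) := by
    rw [zero_smul, add_zero]
    have h1 : ContDiffAt ℝ 1 (balancingMap τ) ((r, e), g) := contDiffAt_balancingMap τ h0
    exact h1.differentiableAt one_ne_zero
  have h1 := hd.hasFDerivAt.comp_hasDerivAt (0 : ℝ) hline
  rw [zero_smul, add_zero] at h1
  have htr : HasDerivAt (fun t : ℝ => (g + t • X).trace) X.trace 0 := by
    simp only [trace_add, trace_smul]
    simpa using ((hasDerivAt_id (0 : ℝ)).smul_const X.trace).const_add g.trace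
  have h2a : HasDerivAt (fun t : ℝ => ∑ i, rescale r (g + t • X) e i)
      (∑ i, (((r i : ℂ) * (g * e i * g).trace⁻¹) • (X * e i * g + g * e i * X) -
        ((r i : ℂ) * ((X * e i * g + g * e i * X).trace * ((g * e i * g).trace ^ 2)⁻¹)) •
          (g * e i * g))) 0 :=
    HasDerivAt.fun_sum fun i _ => hasDerivAt_withTrace_line (r i) (h0 i) X
  have h2b : HasDerivAt (fun t : ℝ => ((meanLength m r : ℂ) + (g + t • X).trace - τ) •
      (1 : Matrix (Fin (m + 1)) (Fin (m + 1)) ℂ)) (X.trace • 1) 0 :=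
    ((htr.const_add (meanLength m r : ℂ)).sub_const (τ : ℂ)).smul_const
      (1 : Matrix (Fin (m + 1)) (Fin (m + 1)) ℂ)
  refine (h1.unique (h2a.fun_sub h2b)).trans ?_
  congr 1
  rw [smul_add, ← Matrix.mul_smul, ← Matrix.smul_mul, eq_comm]
  have hL := sum_closedPolygon hg.2
  have h3 : X * ((meanLength m r : ℂ) • g⁻¹) = ∑ i, X * g⁻¹ * rescale r g e i := by
    rw [← Finset.mul_sum, hL, Matrix.mul_smul, Matrix.mul_smul, mul_one]
  have h4 : ((meanLength m r : ℂ) • g⁻¹) * X = ∑ i, rescale r g e i * (g⁻¹ * X) := by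
    rw [← Finset.sum_mul, hL, Matrix.smul_mul, Matrix.smul_mul, one_mul]
  rw [h3, h4, ← Finset.sum_add_distrib, ← Finset.sum_sub_distrib]
  refine Finset.sum_congr rfl fun i _ => ?_
  have hri : (r i : ℂ) ≠ 0 := by exact_mod_cast (hr i).ne'
  have h5 : X * g⁻¹ * rescale r g e i + rescale r g e i * (g⁻¹ * X) =
      ((r i : ℂ) * (g * e i * g).trace⁻¹) • (X * e i * g + g * e i * X) := by
    rw [rescale, withTrace, Matrix.mul_smul, Matrix.smul_mul, ← smul_add]
    congr 2
    · calc _ = X * (g⁻¹ * g) * e i * g := by simp only [mul_assoc]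
        _ = _ := by rw [hig, mul_one]
    · calc _ = g * e i * (g * g⁻¹) * X := by simp only [mul_assoc]
        _ = _ := by rw [hgi, mul_one]
  have h6 : ((X * g⁻¹ + g⁻¹ * X) * rescale r g e i).trace =
      ((r i : ℂ) * (g * e i * g).trace⁻¹) * (X * e i * g + g * e i * X).trace := by
    rw [← smul_eq_mul (_ * _) (trace _), ← trace_smul, ← h5, add_mul, trace_add, trace_add,
      trace_mul_comm (rescale r g e i)]
  have h7 : rescale r g e i = ((r i : ℂ) * (g * e i * g).trace⁻¹) • (g * e i * g) := rfl
  rw [h5, h6, h7, smul_smul]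
  congr 2
  field_simp

/-- Off the walls the equation for the balancing matrix is nondegenerate. -/
theorem eq_zero_of_fderiv_balancingMap (hn : 0 < n) (τ : ℝ) {r s : Fin n → ℝ} (hr : r ∈ cone n m)
    (hw : r ∉ wallUnion n m) (hs : ∀ i, 0 < s i) {e : Tuple n m} (he : e ∈ linkages m s)
    {g : Matrix (Fin (m + 1)) (Fin (m + 1)) ℂ} (hg : Balances r g e)
    {X : Matrix (Fin (m + 1)) (Fin (m + 1)) ℂ}
    (hX : fderiv ℝ (balancingMap τ) ((r, e), g) (0, X) = 0) : X = 0 := by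
  rw [fderiv_balancingMap_apply τ hr.1 hs he hg] at hX
  set Z := X * g⁻¹ + g⁻¹ * X with hZ
  have htrX : X.trace = 0 := by
    have h1 := congrArg trace hX
    rw [trace_sub, trace_sub, trace_smul, trace_sum, trace_smul, trace_one, trace_zero] at h1
    have h2 : ∀ i, (((r i : ℂ)⁻¹ * (Z * rescale r g e i).trace) • rescale r g e i).trace =
        (Z * rescale r g e i).trace := by
      intro i
      have hri : (r i : ℂ) ≠ 0 := by exact_mod_cast (hr.1 i).ne'
      rw [trace_smul, trace_edge (hg.2.1 i), smul_eq_mul]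
      field_simp
    simp only [h2] at h1
    rw [sum_trace_mul_closedPolygon hg.2, smul_eq_mul, sub_self, zero_sub, neg_eq_zero,
      smul_eq_mul] at h1
    exact (mul_eq_zero.1 h1).resolve_right (by simpa using Nat.cast_add_one_ne_zero (R := ℂ) m)
  rw [htrX, zero_smul, sub_zero] at hX
  -- `X g⁻¹ + g⁻¹ X` is a scalar `c`, hence `X` is the multiple `c / 2` of `g`; its trace is zero
  obtain ⟨c, hc⟩ := eq_smul_one_of_smul_eq_sum hn hr hw hg.2 (sub_eq_zero.1 hX)
  have h3 : X - (c / 2) • g = 0 := by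
    refine eq_zero_of_mul_add_mul_eq_zero hg.1.inv hg.1.inv ?_
    rw [sub_mul, mul_sub, Matrix.smul_mul, Matrix.mul_smul, posDef_mul_inv hg.1,
      posDef_inv_mul hg.1]
    have : X * g⁻¹ + g⁻¹ * X = (c / 2) • 1 + (c / 2) • 1 := by
      rw [← hZ, hc, ← add_smul, add_halves]
    rw [sub_add_sub_comm, this, sub_self]
  have h4 : X = (c / 2) • g := sub_eq_zero.1 h3
  rw [h4, trace_smul, smul_eq_mul] at htrX
  rw [h4, (mul_eq_zero.1 htrX).resolve_right hg.1.trace_pos.ne', zero_smul]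

theorem balancingMap_conjTranspose (τ : ℝ) (r : Fin n → ℝ) {e : Tuple n m}
    (he : ∀ i, (e i).IsHermitian) (g : Matrix (Fin (m + 1)) (Fin (m + 1)) ℂ) :
    balancingMap τ ((r, e), gᴴ) = (balancingMap τ ((r, e), g))ᴴ := by
  unfold balancingMap rescale withTrace
  have h1 : ∀ i, gᴴ * e i * gᴴ = (g * e i * g)ᴴ := fun i => by
    rw [conjTranspose_mul, conjTranspose_mul, he i, mul_assoc]
  simp only [h1, trace_conjTranspose, conjTranspose_sub, conjTranspose_sum, conjTranspose_smul,
    conjTranspose_one, star_sub, star_add, star_mul', star_inv₀]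
  simp

/-- Positive definiteness is an open condition on Hermitian matrices. -/
theorem eventually_posDef {g : Matrix (Fin (m + 1)) (Fin (m + 1)) ℂ} (hg : g.PosDef) :
    ∀ᶠ h in 𝓝 g, h.IsHermitian → h.PosDef := by
  have hcomp : IsCompact (Metric.sphere (0 : Fin (m + 1) → ℂ) 1) := isCompact_sphere _ _
  have hcont : Continuous fun p : Matrix (Fin (m + 1)) (Fin (m + 1)) ℂ × (Fin (m + 1) → ℂ) =>
      (star p.2 ⬝ᵥ p.1 *ᵥ p.2).re := by
    refine Complex.continuous_re.comp ?_
    exact (continuous_snd.star).dotProduct (continuous_fst.matrix_mulVec continuous_snd)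
  have h1 : ∀ᶠ h in 𝓝 g, ∀ x ∈ Metric.sphere (0 : Fin (m + 1) → ℂ) 1,
      0 < (star x ⬝ᵥ h *ᵥ x).re := by
    refine hcomp.eventually_forall_of_forall_eventually fun x hx => ?_
    have hx0 : x ≠ 0 := by
      rintro rfl
      simp at hx
    have := (Complex.pos_iff.1 (hg.dotProduct_mulVec_pos hx0)).1
    exact hcont.continuousAt.eventually (lt_mem_nhds this)
  filter_upwards [h1] with h hh hherm
  refine PosDef.of_dotProduct_mulVec_pos hherm fun x hx => ?_
  have hx' : ‖x‖ ≠ 0 := norm_ne_zero_iff.2 hx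
  have h2 := hh ((‖x‖ : ℂ)⁻¹ • x) (by
    rw [mem_sphere_zero_iff_norm, norm_smul, norm_inv, Complex.norm_real, norm_norm,
      inv_mul_cancel₀ hx'])
  rw [star_smul, mulVec_smul, smul_dotProduct, dotProduct_smul, smul_smul, Complex.star_def,
    map_inv₀, Complex.conj_ofReal, ← Complex.ofReal_inv, ← Complex.ofReal_mul, smul_eq_mul,
    Complex.re_ofReal_mul] at h2
  refine Complex.pos_iff.2 ⟨pos_of_mul_pos_right h2 (mul_self_nonneg _), ?_⟩
  have h3 : star (star x ⬝ᵥ h *ᵥ x) = star x ⬝ᵥ h *ᵥ x := by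
    rw [← star_dotProduct_star, star_star, star_mulVec, hherm, dotProduct_mulVec,
      dotProduct_comm]
  exact (Complex.conj_eq_iff_im.1 h3).symm

/-- The balancing matrix exists near a balanced polygon off the walls, and can be chosen to depend
analytically on the polygon and the side lengths. -/
theorem exists_local_balancing (hn : 0 < n) {r s : Fin n → ℝ} (hr : r ∈ cone n m)
    (hw : r ∉ wallUnion n m) (hs : ∀ i, 0 < s i) {e : Tuple n m} (he : e ∈ linkages m s)
    {g : Matrix (Fin (m + 1)) (Fin (m + 1)) ℂ} (hg : Balances r g e) :
    ∃ γ : (Fin n → ℝ) × Tuple n m → Matrix (Fin (m + 1)) (Fin (m + 1)) ℂ,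
      ContDiffAt ℝ ω γ (r, e) ∧ γ (r, e) = g ∧
      ∀ᶠ x in 𝓝 (r, e), ∀ t : Fin n → ℝ, (∀ i, 0 < t i) → x.2 ∈ linkages m t →
        Balances x.1 (γ x) x.2 := by
  have h0 : ∀ i, (g * e i * g).trace ≠ 0 := fun i => trace_mul_edge_mul_ne_zero (hs i) (he i) hg.1
  set τ : ℝ := g.trace.re with hτ
  have hτg : g.trace = τ := Complex.ext rfl (Complex.pos_iff.1 hg.1.trace_pos).2.symm
  have hcd : ContDiffAt ℝ ω (balancingMap τ) ((r, e), g) := contDiffAt_balancingMap τ h0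
  have hzero : balancingMap τ ((r, e), g) = 0 := by
    unfold balancingMap
    rw [sum_closedPolygon hg.2, hτg, add_sub_cancel_right, sub_self]
  have hinv : (fderiv ℝ (balancingMap τ) ((r, e), g) ∘L
      .inr ℝ ((Fin n → ℝ) × Tuple n m) (Matrix (Fin (m + 1)) (Fin (m + 1)) ℂ)).IsInvertible := by
    set L := fderiv ℝ (balancingMap τ) ((r, e), g) ∘L
      .inr ℝ ((Fin n → ℝ) × Tuple n m) (Matrix (Fin (m + 1)) (Fin (m + 1)) ℂ)
    have hinj : Function.Injective (L : Matrix (Fin (m + 1)) (Fin (m + 1)) ℂ →ₗ[ℝ]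
        Matrix (Fin (m + 1)) (Fin (m + 1)) ℂ) := by
      rw [injective_iff_map_eq_zero]
      intro X hX
      exact eq_zero_of_fderiv_balancingMap hn τ hr hw hs he hg hX
    refine ⟨(LinearEquiv.ofInjectiveEndo _ hinj).toContinuousLinearEquiv, ?_⟩
    ext1 X
    rfl
  have hω : (ω : WithTop ℕ∞) ≠ 0 := by simp
  refine ⟨hcd.implicitFunction hω hinv, hcd.contDiffAt_implicitFunction hω hinv,
    hcd.implicitFunction_apply_self hω hinv, ?_⟩
  have hself := hcd.implicitFunction_apply_self hω hinv
  set γ := hcd.implicitFunction hω hinv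
  change γ (r, e) = g at hself
  have hγ : Tendsto γ (𝓝 (r, e)) (𝓝 g) := by
    have : Tendsto γ (𝓝 (r, e)) (𝓝 (γ (r, e))) :=
      (hcd.contDiffAt_implicitFunction hω hinv).continuousAt.tendsto
    rwa [hself] at this
  have hγs : Tendsto (fun x => (x, (γ x)ᴴ)) (𝓝 (r, e)) (𝓝 ((r, e), g)) := by
    refine tendsto_id.prodMk_nhds ?_
    have := (continuous_id.matrix_conjTranspose.tendsto g).comp hγ
    rw [id, hg.1.1] at this
    exact this
  filter_upwards [hcd.eventually_apply_implicitFunction hω hinv, hγ.eventually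
    (eventually_posDef hg.1), hγs.eventually (hcd.eventually_apply_eq_iff_implicitFunction hω hinv)]
    with x h1 h2 h3 t ht hx
  rw [hzero] at h1 h3
  -- local uniqueness forces the solution to be Hermitian
  have hherm : (γ x).IsHermitian := (h3.1 (by
    have := balancingMap_conjTranspose τ x.1 (fun i => edge_isHermitian (hx i)) (γ x)
    rw [this]
    exact (congrArg conjTranspose h1).trans (conjTranspose_zero))).symm
  have hpd := h2 hherm
  have hlink := rescale_mem_linkages ht hx hpd x.1
  refine ⟨hpd, hlink, ?_⟩
  have h4 : ∑ i, rescale x.1 (γ x) x.2 i = ((meanLength m x.1 : ℂ) + (γ x).trace - τ) • 1 :=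
    sub_eq_zero.1 h1
  -- the trace of the equation shows that the added multiple of the identity vanishes
  have h5 : (γ x).trace - τ = 0 := by
    have h6 := congrArg trace h4
    rw [trace_sum, trace_smul, trace_one] at h6
    simp only [fun i => trace_edge (hlink i)] at h6
    rw [← Complex.ofReal_sum, ← meanLength_mul m x.1, smul_eq_mul] at h6
    push_cast [Fintype.card_fin] at h6
    have h7 := mul_right_cancel₀ (Nat.cast_add_one_ne_zero (R := ℂ) m) h6
    linear_combination -h7
  rw [h4, add_sub_assoc, h5, add_zero]
  rfl

/-! ### Existence of the balancing matrix over a chamber -/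

theorem Balances.smul {r : Fin n → ℝ} {g : Matrix (Fin (m + 1)) (Fin (m + 1)) ℂ} {e : Tuple n m}
    (h : Balances r g e) {c : ℂ} (hc : 0 < c) : Balances r (c • g) e :=
  ⟨h.1.smul hc, by rw [rescale_smul r hc.ne']; exact h.2⟩

theorem balances_one {s : Fin n → ℝ} (hs : ∀ i, 0 < s i) {e : Tuple n m}
    (he : e ∈ closedPolygons m s) : Balances s 1 e :=
  ⟨PosDef.one, by rwa [rescale_one hs he.1]⟩

theorem posSemidef_of_tendsto {u : ℕ → Matrix (Fin (m + 1)) (Fin (m + 1)) ℂ}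
    {g : Matrix (Fin (m + 1)) (Fin (m + 1)) ℂ} (hu : ∀ j, (u j).PosSemidef)
    (hg : Tendsto u atTop (𝓝 g)) : g.PosSemidef := by
  refine PosSemidef.of_dotProduct_mulVec_nonneg ?_ fun x => ?_
  · have h1 : Tendsto (fun j => (u j)ᴴ) atTop (𝓝 gᴴ) :=
      (continuous_id.matrix_conjTranspose.tendsto g).comp hg
    simp only [fun j => (hu j).1.eq] at h1
    exact tendsto_nhds_unique h1 hg
  · have hc : Continuous fun A : Matrix (Fin (m + 1)) (Fin (m + 1)) ℂ => star x ⬝ᵥ A *ᵥ x :=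
      continuous_const.dotProduct (continuous_id.matrix_mulVec continuous_const)
    exact ge_of_tendsto' ((hc.tendsto g).comp hg) fun j => (hu j).dotProduct_mulVec_nonneg x

theorem continuous_meanLength : Continuous (meanLength m : (Fin n → ℝ) → ℝ) := by
  unfold meanLength
  fun_prop

/-- Off the walls a limit of balanced polygons is balanced. If the limit `g` of the balancing
matrices were singular, then the edges in the kernel of `g` would have the total length of a closed
polygon in this kernel. -/
theorem balances_of_tendsto (hn : 0 < n) {r s : Fin n → ℝ} (hr : r ∈ cone n m)
    (hw : r ∉ wallUnion n m) (hs : ∀ i, 0 < s i) {e : Tuple n m} (he : e ∈ linkages m s)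
    {ρ : ℕ → Fin n → ℝ} (hρ : Tendsto ρ atTop (𝓝 r))
    {u : ℕ → Matrix (Fin (m + 1)) (Fin (m + 1)) ℂ} (hu : ∀ j, Balances (ρ j) (u j) e)
    {g : Matrix (Fin (m + 1)) (Fin (m + 1)) ℂ} (hg : Tendsto u atTop (𝓝 g)) (hg0 : g ≠ 0) :
    Balances r g e := by
  classical
  have hpsd : g.PosSemidef := posSemidef_of_tendsto (fun j => (hu j).1.posSemidef) hg
  have hρi : ∀ i, Tendsto (fun j => ((ρ j i : ℝ) : ℂ)) atTop (𝓝 (r i : ℂ)) := fun i =>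
    (Complex.continuous_ofReal.tendsto _).comp (tendsto_pi_nhds.1 hρ i)
  have hL : Tendsto (fun j => (meanLength m (ρ j) : ℂ)) atTop (𝓝 (meanLength m r : ℂ)) :=
    (Complex.continuous_ofReal.tendsto _).comp ((continuous_meanLength.tendsto r).comp hρ)
  have hedge : ∀ i, Tendsto (fun j => u j * e i * u j) atTop (𝓝 (g * e i * g)) := fun i =>
    (hg.mul tendsto_const_nhds).mul hg
  have htr : ∀ i, Tendsto (fun j => (u j * e i * u j).trace) atTop (𝓝 (g * e i * g).trace) :=
    fun i => (continuous_id.matrix_trace.tendsto _).comp (hedge i)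
  by_cases hpd : g.PosDef
  · refine ⟨hpd, rescale_mem_linkages hs he hpd r, ?_⟩
    have h1 : Tendsto (fun j => ∑ i, rescale (ρ j) (u j) e i) atTop
        (𝓝 (∑ i, rescale r g e i)) := by
      refine tendsto_finsetSum _ fun i _ => ?_
      exact ((hρi i).mul ((htr i).inv₀ (trace_mul_edge_mul_ne_zero (hs i) (he i) hpd))).smul
        (hedge i)
    simp only [fun j => sum_closedPolygon (hu j).2] at h1
    exact tendsto_nhds_unique h1 (hL.smul_const _)
  exfalso
  obtain ⟨Q, d, htrQ, hgQ, -, hQ, hd, hd0, hd1⟩ := exists_spectralProjection hpsd.1 0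
  rw [Complex.ofReal_zero, zero_smul] at hgQ
  simp only [Complex.ofReal_zero, zero_smul] at hQ
  have hd1' : d ≠ m + 1 := by
    intro h
    rw [hd1 h, mul_one] at hgQ
    exact hg0 hgQ
  have hd0' : d ≠ 0 := by
    intro h
    have hdet : g.det = 0 := by
      by_contra hdet
      exact hpd (hpsd.posDef_iff_det_ne_zero.2 hdet)
    obtain ⟨v, hv, hgv⟩ := Matrix.exists_mulVec_eq_zero_iff.2 hdet
    have h1 := hQ (vecMulVec v v) (by rw [mul_vecMulVec, hgv, zero_vecMulVec])
    rw [hd0 h, zero_mul] at h1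
    exact vecMulVec_ne_zero hv hv h1.symm
  -- the closing condition for `u j`, conjugated by `u j` and paired with the projection `Q` to
  -- the kernel of `g`
  have hsum : ∀ j, ∑ i, (ρ j i : ℂ) * ((u j * e i * u j).trace)⁻¹ *
      (Q * (e i * (u j * u j))).trace = meanLength m (ρ j) * d := by
    intro j
    have h1 := sum_trace_mul_closedPolygon (hu j).2 (u j * Q * (u j)⁻¹)
    rw [trace_mul_comm, ← mul_assoc, posDef_inv_mul (hu j).1, one_mul, htrQ] at h1
    rw [← h1]
    refine Finset.sum_congr rfl fun i _ => ?_
    rw [rescale, withTrace, Matrix.mul_smul, trace_smul, smul_eq_mul]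
    congr 1
    calc _ = ((Q * e i * u j) * u j).trace := by simp only [mul_assoc]
      _ = (u j * (Q * e i * u j)).trace := trace_mul_comm _ _
      _ = (u j * Q * ((u j)⁻¹ * u j) * e i * u j).trace := by
        rw [posDef_inv_mul (hu j).1, mul_one]; simp only [mul_assoc]
      _ = _ := by simp only [mul_assoc]
  have hlim : ∀ i, Tendsto (fun j => (ρ j i : ℂ) * ((u j * e i * u j).trace)⁻¹ *
      (Q * (e i * (u j * u j))).trace) atTop (𝓝 (if g * e i = 0 then (r i : ℂ) else 0)) := by
    intro i
    split_ifs with h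
    · refine (hρi i).congr fun j => ?_
      have h0 := trace_mul_edge_mul_ne_zero (hs i) (he i) (hu j).1
      rw [← mul_assoc Q, hQ _ h, ← mul_assoc (e i), trace_mul_comm (e i * u j), ← mul_assoc (u j),
        mul_assoc, inv_mul_cancel₀ h0, mul_one]
    · have h0 := trace_conj_edge_pos (hs i) (he i) h
      rw [hpsd.1] at h0
      have h1 : Tendsto (fun j => (Q * (e i * (u j * u j))).trace) atTop
          (𝓝 (Q * (e i * (g * g))).trace) :=
        (continuous_id.matrix_trace.tendsto _).comp
          (tendsto_const_nhds.mul (tendsto_const_nhds.mul (hg.mul hg)))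
      have h2 : (Q * (e i * (g * g))).trace = 0 := by
        rw [← mul_assoc, ← mul_assoc, trace_mul_comm, ← mul_assoc, ← mul_assoc, hgQ, zero_mul,
          zero_mul, trace_zero]
      have h3 := ((hρi i).mul ((htr i).inv₀ h0.ne')).mul h1
      rwa [h2, mul_zero] at h3
  have h1 := tendsto_finsetSum Finset.univ fun i _ => hlim i
  simp only [hsum] at h1
  have h2 := tendsto_nhds_unique h1 (hL.mul_const (d : ℂ))
  rw [← Finset.sum_filter] at h2
  exact sum_ne_of_not_mem_wallUnion hn hr hw _ hd0' hd hd1' (by exact_mod_cast h2)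

/-- Over a connected set of side lengths off the walls every polygon can be balanced for all side
lengths: these form an open and closed set. -/
theorem exists_balances (hn : 0 < n) {D : Set (Fin n → ℝ)} (hD : D ⊆ cone n m \ wallUnion n m)
    (hconn : IsPreconnected D) {s : Fin n → ℝ} (hsD : s ∈ D) {e : Tuple n m}
    (he : e ∈ closedPolygons m s) {r : Fin n → ℝ} (hr : r ∈ D) : ∃ g, Balances r g e := by
  have hs : ∀ i, 0 < s i := (hD hsD).1.1
  have : PreconnectedSpace D := isPreconnected_iff_preconnectedSpace.1 hconn
  set S : Set D := {r | ∃ g, Balances (r : Fin n → ℝ) g e} with hS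
  have hopen : IsOpen S := by
    rw [isOpen_iff_mem_nhds]
    rintro ρ ⟨g, hg⟩
    obtain ⟨γ, -, -, hγ⟩ := exists_local_balancing hn (hD ρ.2).1 (hD ρ.2).2 hs he.1 hg
    have hc : Tendsto (fun ρ' : D => ((ρ' : Fin n → ℝ), e)) (𝓝 ρ) (𝓝 ((ρ : Fin n → ℝ), e)) :=
      (continuous_subtype_val.prodMk continuous_const).tendsto ρ
    filter_upwards [hc.eventually hγ] with ρ' h
    exact ⟨_, h s hs he.1⟩
  have hclosed : IsClosed S := by
    refine IsSeqClosed.isClosed fun ρ r' hρ hlim => ?_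
    choose g hg using hρ
    have hg0 : ∀ j, 0 < ‖g j‖ := fun j => norm_pos_iff.2 fun h => by
      have := (hg j).1.isUnit
      rw [h] at this
      exact not_isUnit_zero this
    -- balancing matrices of norm one have a convergent subsequence with nonzero limit
    have hinv : ∀ j, Balances (ρ j : Fin n → ℝ) (((‖g j‖⁻¹ : ℝ) : ℂ) • g j) e := fun j =>
      (hg j).smul (by exact_mod_cast inv_pos.2 (hg0 j))
    have hnorm : ∀ j, ((‖g j‖⁻¹ : ℝ) : ℂ) • g j ∈
        Metric.sphere (0 : Matrix (Fin (m + 1)) (Fin (m + 1)) ℂ) 1 := fun j => by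
      rw [mem_sphere_zero_iff_norm, norm_smul, Complex.norm_real, norm_inv, norm_norm,
        inv_mul_cancel₀ (hg0 j).ne']
    have : ProperSpace (Matrix (Fin (m + 1)) (Fin (m + 1)) ℂ) := FiniteDimensional.proper ℝ _
    obtain ⟨g', hg', φ, hφ, hlim'⟩ := (isCompact_sphere _ _).tendsto_subseq hnorm
    refine ⟨g', balances_of_tendsto hn (hD r'.2).1 (hD r'.2).2 hs he.1
      (((continuous_subtype_val.tendsto r').comp hlim).comp hφ.tendsto_atTop)
      (fun j => hinv (φ j)) hlim' ?_⟩
    rintro rfl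
    simp at hg'
  have huniv := IsClopen.eq_univ ⟨hclosed, hopen⟩ ⟨⟨s, hsD⟩, 1, balances_one hs he⟩
  have : (⟨r, hr⟩ : D) ∈ S := by rw [huniv]; trivial
  exact this

/-! ### Diffeomorphisms and quotient maps -/

section Smooth

variable {E F G : Type*} [NormedAddCommGroup E] [NormedSpace ℝ E]
  [NormedAddCommGroup F] [NormedSpace ℝ F] [NormedAddCommGroup G] [NormedSpace ℝ G]

theorem SmoothNear.continuousAt {X : Set E} {f : X → F} {x : X} (hf : SmoothNear f x) :
    ContinuousAt f x := by
  obtain ⟨U, hU, hxU, g, hg, hfg⟩ := hf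
  have h1 : ContinuousAt (fun y : X => g y) x :=
    ContinuousAt.comp (f := ((↑) : X → E)) (g := g) (hg.continuousOn.continuousAt
      (hU.mem_nhds hxU)) continuous_subtype_val.continuousAt
  refine h1.congr ?_
  filter_upwards [continuous_subtype_val.continuousAt.preimage_mem_nhds (hU.mem_nhds hxU)]
    with y hy
  exact (hfg y hy).symm

theorem SmoothNear.comp {X : Set E} {Y : Set F} {f : Y → G} {Φ : X → Y} {x : X}
    (hf : SmoothNear f (Φ x)) (hΦ : SmoothNear (fun z : X => (Φ z : F)) x) :
    SmoothNear (fun z => f (Φ z)) x := by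
  obtain ⟨V, hV, hxV, g, hg, hfg⟩ := hf
  obtain ⟨U, hU, hxU, h, hh, hΦh⟩ := hΦ
  refine ⟨U ∩ h ⁻¹' V, hh.continuousOn.isOpen_inter_preimage hU hV, ⟨hxU, ?_⟩, g ∘ h,
    hg.comp (hh.mono Set.inter_subset_left) fun z hz => hz.2, fun z hz => ?_⟩
  · change h x ∈ V
    rw [← hΦh x hxU]
    exact hxV
  · have h1 : (Φ z : F) = h z := hΦh z hz.1
    change _ = g (h z)
    rw [← h1]
    refine hfg _ ?_
    rw [h1]
    exact hz.2

/-- The homeomorphism underlying a diffeomorphism. -/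
def IsDiffeo.toHomeomorph {X : Set E} {Y : Set F} {Φ : X ≃ Y} (hΦ : IsDiffeo Φ) : X ≃ₜ Y where
  toEquiv := Φ
  continuous_toFun := Continuous.subtype_mk
    (continuous_iff_continuousAt.2 fun x => (hΦ.1 x).continuousAt) fun x => (Φ x).2
  continuous_invFun := Continuous.subtype_mk
    (continuous_iff_continuousAt.2 fun y => (hΦ.2 y).continuousAt) fun y => (Φ.symm y).2

theorem IsDiffeo.isQuotientDiffeo {X : Set E} {Y : Set F} {Φ : X ≃ Y} (hΦ : IsDiffeo Φ)
    {P Q : Type*} [TopologicalSpace P] [TopologicalSpace Q] {p : X → P} {q : Y → Q} {φ : P ≃ₜ Q}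
    (hφ : ∀ x, φ (p x) = q (Φ x)) : IsQuotientDiffeo p q φ := by
  intro f a
  constructor
  · intro h x hx
    simp only [hφ]
    exact (h (Φ x) (by rw [← hφ, hx])).comp (hΦ.1 x)
  · intro h y hy
    have hx : p (Φ.symm y) = a := φ.injective (by rw [hφ, Φ.apply_symm_apply, hy])
    have h1 := (h (Φ.symm y) hx).comp (hΦ.2 y)
    simpa only [hφ, Φ.apply_symm_apply] using h1

/-- A homeomorphism that respects the fibres of two quotient maps induces a homeomorphism of the
quotients. -/
theorem exists_homeomorph_of_isQuotientMap {X Y P Q : Type*} [TopologicalSpace X]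
    [TopologicalSpace Y] [TopologicalSpace P] [TopologicalSpace Q] {p : X → P} {q : Y → Q}
    (hp : Topology.IsQuotientMap p) (hq : Topology.IsQuotientMap q) (Φ : X ≃ₜ Y)
    (hΦ : ∀ x x', p x = p x' ↔ q (Φ x) = q (Φ x')) : ∃ φ : P ≃ₜ Q, ∀ x, φ (p x) = q (Φ x) := by
  set a : C(X, Q) := ⟨fun x => q (Φ x), hq.continuous.comp Φ.continuous⟩ with ha
  set b : C(Y, P) := ⟨fun y => p (Φ.symm y), hp.continuous.comp Φ.symm.continuous⟩ with hb
  have hab : Function.FactorsThrough a p := fun x x' h => (hΦ x x').1 h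
  have hba : Function.FactorsThrough b q := fun y y' h => (hΦ _ _).2 (by simpa using h)
  set F : P → Q := fun z => q (Φ (Function.surjInv hp.surjective z)) with hF
  set B : Q → P := fun z => p (Φ.symm (Function.surjInv hq.surjective z)) with hB
  have hFp : ∀ x, F (p x) = q (Φ x) := fun x => hab (Function.surjInv_eq hp.surjective (p x))
  have hBq : ∀ y, B (q y) = p (Φ.symm y) := fun y => hba (Function.surjInv_eq hq.surjective (q y))
  refine ⟨{ toFun := F, invFun := B, left_inv := ?_, right_inv := ?_, continuous_toFun := ?_,
            continuous_invFun := ?_ }, hFp⟩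
  · intro z
    obtain ⟨x, rfl⟩ := hp.surjective z
    rw [hFp, hBq, Φ.symm_apply_apply]
  · intro z
    obtain ⟨y, rfl⟩ := hq.surjective z
    rw [hBq, hFp, Φ.apply_symm_apply]
  · rw [hp.continuous_iff]
    exact a.continuous.congr fun x => (hFp x).symm
  · rw [hq.continuous_iff]
    exact b.continuous.congr fun y => (hBq y).symm

end Smooth

/-! ### Orbit spaces -/

theorem isQuotientMap_toOrbit (X : Set (Tuple n m)) : Topology.IsQuotientMap (toOrbit X) :=
  isQuotientMap_quotient_mk'

theorem toOrbit_eq_iff {X : Set (Tuple n m)} {e e' : X} : toOrbit X e = toOrbit X e' ↔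
    ∃ u ∈ unitaryGroup (Fin (m + 1)) ℂ, (e' : Tuple n m) = fun i => u * (e : Tuple n m) i * star u :=
  Quotient.eq.trans (exists_congr fun _ => and_congr_right fun _ => funext_iff.symm)

theorem isOpenQuotientMap_toOrbit (r : Fin n → ℝ) :
    IsOpenQuotientMap (toOrbit (closedPolygons m r)) := by
  refine ⟨(isQuotientMap_toOrbit _).surjective, (isQuotientMap_toOrbit _).continuous, ?_⟩
  intro V hV
  rw [← (isQuotientMap_toOrbit _).isOpen_preimage]
  have hset : toOrbit (closedPolygons m r) ⁻¹' (toOrbit (closedPolygons m r) '' V) =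
      ⋃ u : unitaryGroup (Fin (m + 1)) ℂ, (fun e : closedPolygons m r =>
        (⟨fun i => (u : Matrix _ _ ℂ) * (e : Tuple n m) i * star (u : Matrix _ _ ℂ),
          conj_mem_closedPolygons e.2 u.2⟩ : closedPolygons m r)) ⁻¹' V := by
    ext e
    simp only [Set.mem_preimage, Set.mem_image, Set.mem_iUnion]
    constructor
    · rintro ⟨e', he', h⟩
      obtain ⟨u, hu, h1⟩ := toOrbit_eq_iff.1 h.symm
      refine ⟨⟨u, hu⟩, ?_⟩
      convert he' using 1
      exact Subtype.ext h1.symm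
    · rintro ⟨u, hu⟩
      exact ⟨_, hu, (toOrbit_eq_iff.2 ⟨u, u.2, rfl⟩).symm⟩
  rw [hset]
  refine isOpen_iUnion fun u => hV.preimage (Continuous.subtype_mk ?_ _)
  refine continuous_pi fun i => ?_
  exact (continuous_const.mul ((continuous_apply i).comp continuous_subtype_val)).mul
    continuous_const

/-! ### Transport of polygons over a chamber -/

theorem closedPolygons_of_mem_CPol {e : Tuple n m} (he : e ∈ CPol n m) :
    (∀ i, 0 < sideLength e i) ∧ e ∈ closedPolygons m (sideLength e) := by
  obtain ⟨r, hr, h⟩ := he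
  rw [sideLength_of_mem h.1]
  exact ⟨hr, h⟩

theorem contDiff_sideLength {k : WithTop ℕ∞} :
    ContDiff ℝ k (sideLength : Tuple n m → Fin n → ℝ) := by
  rw [contDiff_pi]
  intro i
  refine Complex.reCLM.contDiff.comp (contDiff_iff_contDiffAt.2 fun e => ?_)
  exact contDiffAt_matrix_trace (contDiffAt_pi.1 contDiffAt_id i)

/-- A transport of the polygons over `D`: it changes the side lengths from any value in `D` to
any other, compatibly with the conjugation action, smoothly and reversibly. -/
structure IsTransport (D : Set (Fin n → ℝ)) (T : (Fin n → ℝ) × Tuple n m → Tuple n m) :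
    Prop where
  mem : ∀ r ∈ D, ∀ s ∈ D, ∀ e ∈ closedPolygons m s, T (r, e) ∈ closedPolygons m r
  left_inv : ∀ r ∈ D, ∀ s ∈ D, ∀ e ∈ closedPolygons m s, T (s, T (r, e)) = e
  conj : ∀ r ∈ D, ∀ s ∈ D, ∀ e ∈ closedPolygons m s, ∀ u ∈ unitaryGroup (Fin (m + 1)) ℂ,
    T (r, fun i => u * e i * star u) = fun i => u * T (r, e) i * star u
  smooth : ∀ r ∈ D, ∀ s ∈ D, ∀ e ∈ closedPolygons m s, ∃ U : Set ((Fin n → ℝ) × Tuple n m),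
    IsOpen U ∧ (r, e) ∈ U ∧ ∃ G : (Fin n → ℝ) × Tuple n m → Tuple n m, ContDiffOn ℝ ∞ G U ∧
      ∀ r' ∈ D, ∀ s' ∈ D, ∀ e' ∈ closedPolygons m s', (r', e') ∈ U → T (r', e') = G (r', e')

theorem exists_isTransport {D : Set (Fin n → ℝ)} (hD : D ⊆ cone n m \ wallUnion n m)
    (hconn : IsPreconnected D) : ∃ T : (Fin n → ℝ) × Tuple n m → Tuple n m, IsTransport D T := by
  classical
  rcases Nat.eq_zero_or_pos n with rfl | hn
  -- there is only one (empty) polygon without edges, and its mean length is zero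
  · refine ⟨Prod.snd, ?_, fun _ _ _ _ _ _ => Subsingleton.elim _ _,
      fun _ _ _ _ _ _ _ _ => Subsingleton.elim _ _, fun r _ s _ e _ => ⟨Set.univ, isOpen_univ,
        trivial, Prod.snd, contDiffOn_snd, fun _ _ _ _ _ _ _ => rfl⟩⟩
    intro r _ s _ e he
    rwa [Subsingleton.elim r s]
  have hex : ∀ r ∈ D, ∀ s ∈ D, ∀ e ∈ closedPolygons m s, ∃ g, Balances r g e :=
    fun r hr s hs e he => exists_balances hn hD hconn hs he hr
  set T : (Fin n → ℝ) × Tuple n m → Tuple n m := fun x =>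
    if h : ∃ g, Balances x.1 g x.2 then rescale x.1 h.choose x.2 else x.2 with hT
  have hTg : ∀ r ∈ D, ∀ s ∈ D, ∀ e ∈ closedPolygons m s, ∀ g, Balances r g e →
      T (r, e) = rescale r g e := by
    intro r hr s hs e he g hg
    have hgex : ∃ g, Balances (r, e).1 g (r, e).2 := ⟨g, hg⟩
    rw [hT]
    simp only [dif_pos hgex]
    exact Balances.rescale_eq hn (hD hr).1 (hD hr).2 (hD hs).1.1 he.1 hgex.choose_spec hg
  have hmem : ∀ r ∈ D, ∀ s ∈ D, ∀ e ∈ closedPolygons m s, T (r, e) ∈ closedPolygons m r := by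
    intro r hr s hs e he
    obtain ⟨g, hg⟩ := hex r hr s hs e he
    rw [hTg r hr s hs e he g hg]
    exact hg.2
  refine ⟨T, hmem, ?_, ?_, ?_⟩
  · intro r hr s hs e he
    obtain ⟨g, hg⟩ := hex r hr s hs e he
    have hinv := rescale_inv_rescale (hD hs).1.1 he.1 hg.1 (hD hr).1.1
    have h1 := hTg s hs r hr _ hg.2 g⁻¹ ⟨hg.1.inv, by rwa [hinv]⟩
    rw [hTg r hr s hs e he g hg, h1, hinv]
  · intro r hr s hs e he u hu
    obtain ⟨g, hg⟩ := hex r hr s hs e he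
    rw [hTg r hr s hs e he g hg, hTg r hr s hs _ (conj_mem_closedPolygons he hu) _ (hg.conj hu)]
    funext i
    exact rescale_conj r hu g e i
  · intro r hr s hs e he
    obtain ⟨g, hg⟩ := hex r hr s hs e he
    obtain ⟨γ, hγ, hγ0, hbal⟩ := exists_local_balancing hn (hD hr).1 (hD hr).2 (hD hs).1.1 he.1 hg
    -- analyticity at a point, unlike `C^∞` at a point, extends to a neighbourhood
    have hcd : ContDiffAt ℝ ω (fun x : (Fin n → ℝ) × Tuple n m => rescale x.1 (γ x) x.2) (r, e) := by
      refine contDiffAt_rescale contDiffAt_fst hγ contDiffAt_snd fun i => ?_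
      rw [hγ0]
      exact trace_mul_edge_mul_ne_zero ((hD hs).1.1 i) (he.1 i) hg.1
    obtain ⟨U, hUsub, hU, heU⟩ := eventually_nhds_iff.1 ((hcd.eventually (by simp)).and hbal)
    refine ⟨U, hU, heU, fun x => rescale x.1 (γ x) x.2, fun x hx =>
      ((hUsub x hx).1.of_le le_top).contDiffWithinAt, ?_⟩
    intro r' hr' s' hs' e' he' hx
    exact hTg r' hr' s' hs' e' he' _ ((hUsub _ hx).2 s' (hD hs').1.1 he'.1)

theorem mem_polygonsOver {D : Set (Fin n → ℝ)} (hD : D ⊆ cone n m) {s : Fin n → ℝ} (hs : s ∈ D)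
    {e : Tuple n m} (he : e ∈ closedPolygons m s) : e ∈ polygonsOver m D :=
  ⟨⟨s, (hD hs).1, he⟩, by rwa [sideLength_of_mem he.1]⟩

section Transport

variable {D : Set (Fin n → ℝ)} {T : (Fin n → ℝ) × Tuple n m → Tuple n m}

/-- The trivialization of the polygons over `D` by a transport to the side lengths `r`. -/
def IsTransport.trivialization (hT : IsTransport D T) (hD : D ⊆ cone n m) {r : Fin n → ℝ}
    (hr : r ∈ D) :
    polygonsOver m D ≃ (D ×ˢ closedPolygons m r : Set ((Fin n → ℝ) × Tuple n m)) where
  toFun e := ⟨(sideLength (e : Tuple n m), T (r, e)), e.2.2,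
    hT.mem r hr _ e.2.2 _ (closedPolygons_of_mem_CPol e.2.1).2⟩
  invFun z := ⟨T (z.1.1, z.1.2), mem_polygonsOver hD z.2.1 (hT.mem _ z.2.1 r hr _ z.2.2)⟩
  left_inv e := Subtype.ext
    (hT.left_inv r hr _ e.2.2 _ (closedPolygons_of_mem_CPol e.2.1).2)
  right_inv z := by
    have h1 := hT.mem _ z.2.1 r hr _ z.2.2
    refine Subtype.ext (Prod.ext ?_ ?_)
    · exact sideLength_of_mem h1.1
    · exact hT.left_inv _ z.2.1 r hr _ z.2.2

theorem IsTransport.isDiffeo_trivialization (hT : IsTransport D T) (hD : D ⊆ cone n m)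
    {r : Fin n → ℝ} (hr : r ∈ D) : IsDiffeo (hT.trivialization hD hr) := by
  constructor
  · intro e
    obtain ⟨U, hU, heU, G, hG, hTG⟩ :=
      hT.smooth r hr _ e.2.2 _ (closedPolygons_of_mem_CPol e.2.1).2
    have hc : ContDiff ℝ ∞ fun e : Tuple n m => (r, e) := contDiff_const.prodMk contDiff_id
    refine ⟨(fun e => (r, e)) ⁻¹' U, hU.preimage hc.continuous, heU,
      fun e => (sideLength e, G (r, e)),
      contDiff_sideLength.contDiffOn.prodMk (hG.comp hc.contDiffOn fun _ h => h), fun e' he' => ?_⟩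
    exact Prod.ext rfl (hTG r hr _ e'.2.2 _ (closedPolygons_of_mem_CPol e'.2.1).2 he')
  · intro z
    obtain ⟨U, hU, hzU, G, hG, hTG⟩ := hT.smooth _ z.2.1 r hr _ z.2.2
    exact ⟨U, hU, hzU, G, hG, fun z' hz' => hTG _ z'.2.1 r hr _ z'.2.2 hz'⟩

theorem IsTransport.isTrivialBundleOver (hT : IsTransport D T) (hD : D ⊆ cone n m)
    {r : Fin n → ℝ} (hr : r ∈ D) : IsTrivialBundleOver m D r :=
  ⟨hT.trivialization hD hr, hT.isDiffeo_trivialization hD hr, fun _ => rfl⟩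

/-- A transport does not merge or split orbits. -/
theorem IsTransport.conj_iff (hT : IsTransport D T) {r s : Fin n → ℝ} (hr : r ∈ D) (hs : s ∈ D)
    {e e' : Tuple n m} (he : e ∈ closedPolygons m s) (he' : e' ∈ closedPolygons m s)
    {u : Matrix (Fin (m + 1)) (Fin (m + 1)) ℂ} (hu : u ∈ unitaryGroup (Fin (m + 1)) ℂ) :
    (e' = fun i => u * e i * star u) ↔ T (r, e') = fun i => u * T (r, e) i * star u := by
  constructor
  · rintro rfl
    exact hT.conj r hr s hs e he u hu
  · intro h
    have h1 := hT.conj s hs r hr _ (hT.mem r hr s hs e he) u hu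
    rwa [← h, hT.left_inv r hr s hs e he, hT.left_inv r hr s hs e' he'] at h1

theorem sideLength_conj (e : Tuple n m) {u : Matrix (Fin (m + 1)) (Fin (m + 1)) ℂ}
    (hu : u ∈ unitaryGroup (Fin (m + 1)) ℂ) :
    sideLength (fun i => u * e i * star u) = sideLength e := by
  funext i
  rw [sideLength, sideLength, trace_mul_comm, ← mul_assoc, mem_unitaryGroup_iff'.1 hu, one_mul]

theorem IsTransport.isTrivialQuotientBundleOver (hT : IsTransport D T) (hD : D ⊆ cone n m)
    {r : Fin n → ℝ} (hr : r ∈ D) : IsTrivialQuotientBundleOver m D r := by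
  have hdiff := hT.isDiffeo_trivialization hD hr
  have hq : Topology.IsQuotientMap
      (fun z : (D ×ˢ closedPolygons m r : Set ((Fin n → ℝ) × Tuple n m)) =>
        ((⟨z.1.1, z.2.1⟩, toOrbit (closedPolygons m r) ⟨z.1.2, z.2.2⟩) : D × Moduli m r)) :=
    ((IsOpenQuotientMap.id.prodMap (isOpenQuotientMap_toOrbit (m := m) r)).isQuotientMap).comp
      (Homeomorph.Set.prod D (closedPolygons m r)).isQuotientMap
  obtain ⟨φ, hφ⟩ := exists_homeomorph_of_isQuotientMap (isQuotientMap_toOrbit (polygonsOver m D))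
    hq hdiff.toHomeomorph (by
      intro e e'
      have he := (closedPolygons_of_mem_CPol e.2.1).2
      have he' := (closedPolygons_of_mem_CPol e'.2.1).2
      rw [toOrbit_eq_iff, Prod.ext_iff, toOrbit_eq_iff, Subtype.ext_iff]
      constructor
      · rintro ⟨u, hu, h⟩
        have hside : sideLength (e' : Tuple n m) = sideLength (e : Tuple n m) := by
          rw [h, sideLength_conj _ hu]
        refine ⟨hside.symm, u, hu, ?_⟩
        rw [hside] at he'
        exact (hT.conj_iff hr e.2.2 he he' hu).1 h
      · rintro ⟨hside, u, hu, h⟩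
        change sideLength (e : Tuple n m) = sideLength (e' : Tuple n m) at hside
        rw [← hside] at he'
        exact ⟨u, hu, (hT.conj_iff hr e.2.2 he he' hu).2 h⟩)
  refine ⟨φ, hdiff.isQuotientDiffeo hφ, fun e => ?_⟩
  rw [hφ]
  rfl

/-- The transport from the side lengths `r` to the side lengths `r'`. -/
def IsTransport.equiv (hT : IsTransport D T) {r r' : Fin n → ℝ} (hr : r ∈ D) (hr' : r' ∈ D) :
    closedPolygons m r ≃ closedPolygons m r' where
  toFun e := ⟨T (r', e), hT.mem r' hr' r hr e e.2⟩
  invFun e := ⟨T (r, e), hT.mem r hr r' hr' e e.2⟩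
  left_inv e := Subtype.ext (hT.left_inv r' hr' r hr e e.2)
  right_inv e := Subtype.ext (hT.left_inv r hr r' hr' e e.2)

theorem IsTransport.smoothNear_equiv (hT : IsTransport D T) {r r' : Fin n → ℝ} (hr : r ∈ D)
    (hr' : r' ∈ D) (e : closedPolygons m r) :
    SmoothNear (fun z : closedPolygons m r => (hT.equiv hr hr' z : Tuple n m)) e := by
  obtain ⟨U, hU, heU, G, hG, hTG⟩ := hT.smooth r' hr' r hr e e.2
  have hc : ContDiff ℝ ∞ fun e : Tuple n m => (r', e) := contDiff_const.prodMk contDiff_id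
  exact ⟨(fun e => (r', e)) ⁻¹' U, hU.preimage hc.continuous, heU, fun e => G (r', e),
    hG.comp hc.contDiffOn fun _ h => h, fun e' he' => hTG r' hr' r hr e' e'.2 he'⟩

theorem IsTransport.moduliDiffeomorphic (hT : IsTransport D T) {r r' : Fin n → ℝ} (hr : r ∈ D)
    (hr' : r' ∈ D) : ModuliDiffeomorphic m r r' := by
  have hdiff : IsDiffeo (hT.equiv hr hr') :=
    ⟨hT.smoothNear_equiv hr hr', hT.smoothNear_equiv hr' hr⟩
  obtain ⟨φ, hφ⟩ := exists_homeomorph_of_isQuotientMap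
    (isQuotientMap_toOrbit (closedPolygons m r)) (isQuotientMap_toOrbit (closedPolygons m r'))
    hdiff.toHomeomorph (fun e e' => by
      rw [toOrbit_eq_iff, toOrbit_eq_iff]
      exact exists_congr fun u => and_congr_right fun hu => hT.conj_iff hr' hr e.2 e'.2 hu)
  exact ⟨φ, hdiff.isQuotientDiffeo hφ⟩

end Transport

/-! ### Frames with prescribed lengths -/

theorem trace_vecMulVec_star (v : Fin (m + 1) → ℂ) :
    (vecMulVec v (star v)).trace = star v ⬝ᵥ v := by
  rw [trace_vecMulVec, dotProduct_comm]

/-- A rotation in the span of two vectors does not change the sum of their rank one matrices. -/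
theorem vecMulVec_rotate_add (x y : Fin (m + 1) → ℂ) (θ : ℝ) :
    vecMulVec ((Real.cos θ : ℂ) • x + (Real.sin θ : ℂ) • y)
        (star ((Real.cos θ : ℂ) • x + (Real.sin θ : ℂ) • y)) +
      vecMulVec ((-Real.sin θ : ℂ) • x + (Real.cos θ : ℂ) • y)
        (star ((-Real.sin θ : ℂ) • x + (Real.cos θ : ℂ) • y)) =
      vecMulVec x (star x) + vecMulVec y (star y) := by
  have h : (Real.cos θ : ℂ) ^ 2 + (Real.sin θ : ℂ) ^ 2 = 1 := by
    exact_mod_cast Real.cos_sq_add_sin_sq θ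
  ext a b
  simp only [Matrix.add_apply, vecMulVec_apply, Pi.add_apply, Pi.smul_apply, Pi.star_apply,
    smul_eq_mul, star_add, star_mul', star_neg, Complex.star_def, Complex.conj_ofReal]
  linear_combination (x a * (starRingEnd ℂ) (x b) + y a * (starRingEnd ℂ) (y b)) * h

/-- Two vectors can be rotated so that the square of the length of the first takes any value
between those of the two vectors. -/
theorem exists_rotate {x y : Fin (m + 1) → ℂ} {a b c : ℝ} (hx : star x ⬝ᵥ x = a)
    (hy : star y ⬝ᵥ y = b) (hc : c ∈ Set.uIcc a b) : ∃ x' y' : Fin (m + 1) → ℂ,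
      star x' ⬝ᵥ x' = c ∧ star y' ⬝ᵥ y' = ((a + b - c : ℝ) : ℂ) ∧
      vecMulVec x' (star x') + vecMulVec y' (star y') =
        vecMulVec x (star x) + vecMulVec y (star y) := by
  set w : ℝ → Fin (m + 1) → ℂ := fun θ => (Real.cos θ : ℂ) • x + (Real.sin θ : ℂ) • y with hw
  set f : ℝ → ℝ := fun θ => (star (w θ) ⬝ᵥ w θ).re with hf
  have hwc : Continuous w := by
    refine ((Complex.continuous_ofReal.comp Real.continuous_cos).smul continuous_const).add
      ((Complex.continuous_ofReal.comp Real.continuous_sin).smul continuous_const)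
  have hfc : Continuous f := Complex.continuous_re.comp (hwc.star.dotProduct hwc)
  have hfw : ∀ θ, star (w θ) ⬝ᵥ w θ = f θ := fun θ =>
    Complex.ext rfl (Complex.nonneg_iff.1 (dotProduct_star_self_nonneg (w θ))).2.symm
  have hf0 : f 0 = a := by simp [hf, hw, hx]
  have hf1 : f (Real.pi / 2) = b := by simp [hf, hw, hy]
  obtain ⟨θ, -, hθ⟩ := intermediate_value_uIcc (a := 0) (b := Real.pi / 2) hfc.continuousOn
    (by rw [hf0, hf1]; exact hc)
  have hrot := vecMulVec_rotate_add x y θ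
  refine ⟨w θ, (-Real.sin θ : ℂ) • x + (Real.cos θ : ℂ) • y, by rw [hfw, hθ], ?_, hrot⟩
  have htr := congrArg trace hrot
  simp only [trace_add, trace_vecMulVec_star, hx, hy] at htr
  change star (w θ) ⬝ᵥ w θ + _ = _ at htr
  rw [hfw, hθ] at htr
  rw [Complex.ofReal_sub, Complex.ofReal_add]
  linear_combination htr

/-- There are vectors of prescribed lengths whose rank one matrices add up to the projection to a
coordinate subspace, provided that the lengths are at most one and have the right sum of squares.
By induction on the number of lengths different from zero and one: for two such lengths one of
them can be changed to zero or one, and a rotation restores the original lengths. -/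
theorem exists_frame (A : Finset (Fin (m + 1))) (I : Finset (Fin n)) (p : Fin n → ℝ)
    (hp : ∀ i ∈ I, 0 ≤ p i ∧ p i ≤ 1) (hsum : ∑ i ∈ I, p i = A.card) :
    ∃ v : Fin n → Fin (m + 1) → ℂ, (∀ i ∈ I, star (v i) ⬝ᵥ v i = p i) ∧
      ∑ i ∈ I, vecMulVec (v i) (star (v i)) = diagonal fun a => if a ∈ A then 1 else 0 := by
  classical
  induction hN : (I.filter fun i => p i ≠ 0 ∧ p i ≠ 1).card using Nat.strong_induction_on
    generalizing p with
  | _ N ih =>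
  by_cases hfrac : ∃ i ∈ I, p i ≠ 0 ∧ p i ≠ 1
  · obtain ⟨i, hi, hi0, hi1⟩ := hfrac
    obtain ⟨j, hj, hji, hj0, hj1⟩ : ∃ j ∈ I, j ≠ i ∧ p j ≠ 0 ∧ p j ≠ 1 := by
      by_contra hno
      push Not at hno
      have h1 : ∑ j ∈ I.erase i, p j = ((I.erase i).filter fun j => p j = 1).card := by
        rw [Finset.card_filter]
        push_cast
        refine Finset.sum_congr rfl fun j hj => ?_
        obtain ⟨hji, hjI⟩ := Finset.mem_erase.1 hj
        by_cases h0 : p j = 0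
        · simp [h0]
        · simp [hno j hjI hji h0]
      rw [← Finset.add_sum_erase I p hi, h1] at hsum
      have h2 : 0 < p i := lt_of_le_of_ne (hp i hi).1 (Ne.symm hi0)
      have h3 : p i < 1 := lt_of_le_of_ne (hp i hi).2 hi1
      have h4 : (((I.erase i).filter fun j => p j = 1).card : ℝ) < A.card := by linarith
      have h5 : (A.card : ℝ) < ((I.erase i).filter fun j => p j = 1).card + 1 := by linarith
      have h6 : ((I.erase i).filter fun j => p j = 1).card < A.card := by exact_mod_cast h4
      have h7 : A.card < ((I.erase i).filter fun j => p j = 1).card + 1 := by exact_mod_cast h5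
      omega
    -- the new value `b` of the length at `i`; the value at `j` absorbs the difference
    obtain ⟨b, hb, hb0, hb1, hbu⟩ : ∃ b : ℝ, (b = 0 ∨ b = 1) ∧ 0 ≤ p i + p j - b ∧
        p i + p j - b ≤ 1 ∧ p i ∈ Set.uIcc b (p i + p j - b) := by
      have := hp i hi
      have := hp j hj
      by_cases h : p i + p j ≤ 1
      · exact ⟨0, Or.inl rfl, by linarith, by linarith,
          Set.mem_uIcc.2 (Or.inl ⟨by linarith, by linarith⟩)⟩
      · exact ⟨1, Or.inr rfl, by linarith, by linarith,
          Set.mem_uIcc.2 (Or.inr ⟨by linarith, by linarith⟩)⟩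
    set q : Fin n → ℝ := Function.update (Function.update p j (p i + p j - b)) i b with hq
    have hqi : q i = b := by simp [hq]
    have hqj : q j = p i + p j - b := by simp [hq, hji]
    have hqk : ∀ k, k ≠ i → k ≠ j → q k = p k := fun k hki hkj => by simp [hq, hki, hkj]
    have hsplit : ∀ {M : Type} [AddCommMonoid M] (f : Fin n → M),
        ∑ k ∈ I, f k = f i + f j + ∑ k ∈ (I.erase i).erase j, f k := by
      intro M _ f
      rw [add_assoc, Finset.add_sum_erase _ _ (Finset.mem_erase.2 ⟨hji, hj⟩),
        Finset.add_sum_erase _ _ hi]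
    have hrest : ∀ {M : Type} [AddCommMonoid M] (f f' : Fin n → M),
        (∀ k, k ≠ i → k ≠ j → f k = f' k) →
        ∑ k ∈ (I.erase i).erase j, f k = ∑ k ∈ (I.erase i).erase j, f' k := by
      intro M _ f f' h
      refine Finset.sum_congr rfl fun k hk => ?_
      obtain ⟨hkj, hk⟩ := Finset.mem_erase.1 hk
      exact h k (Finset.mem_erase.1 hk).1 hkj
    obtain ⟨v, hv, hvsum⟩ := ih _ (by
      rw [← hN]
      refine Finset.card_lt_card (Finset.ssubset_iff_of_subset ?_ |>.2 ⟨i, ?_, ?_⟩)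
      · intro k hk
        obtain ⟨hkI, hk0, hk1⟩ := Finset.mem_filter.1 hk
        have hki : k ≠ i := by
          rintro rfl
          rw [hqi] at hk0 hk1
          exact hb.elim hk0 hk1
        by_cases hkj : k = j
        · rw [hkj]
          exact Finset.mem_filter.2 ⟨hj, hj0, hj1⟩
        · rw [hqk k hki hkj] at hk0 hk1
          exact Finset.mem_filter.2 ⟨hkI, hk0, hk1⟩
      · exact Finset.mem_filter.2 ⟨hi, hi0, hi1⟩
      · rw [Finset.mem_filter, hqi]
        rintro ⟨-, h0, h1⟩
        exact hb.elim h0 h1) q (by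
      intro k hk
      by_cases hki : k = i
      · rw [hki, hqi]
        rcases hb with rfl | rfl <;> norm_num
      by_cases hkj : k = j
      · rw [hkj, hqj]
        exact ⟨hb0, hb1⟩
      · rw [hqk k hki hkj]
        exact hp k hk) (by
      rw [← hsum, hsplit q, hsplit p, hrest q p hqk, hqi, hqj]
      ring) rfl
    obtain ⟨x, y, hx, hy, hxy⟩ := exists_rotate (by rw [hv i hi, hqi]) (by rw [hv j hj, hqj]) hbu
    set v' : Fin n → Fin (m + 1) → ℂ := Function.update (Function.update v j y) i x with hv'
    have hvi : v' i = x := by simp [hv']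
    have hvj : v' j = y := by simp [hv', hji]
    have hvk : ∀ k, k ≠ i → k ≠ j → v' k = v k := fun k hki hkj => by simp [hv', hki, hkj]
    refine ⟨v', fun k hk => ?_, ?_⟩
    · by_cases hki : k = i
      · rw [hki, hvi, hx]
      by_cases hkj : k = j
      · rw [hkj, hvj, hy]
        congr 1
        ring
      · rw [hvk k hki hkj, hv k hk, hqk k hki hkj]
    · rw [← hvsum, hsplit, hsplit fun k => vecMulVec (v k) (star (v k)),
        hrest _ (fun k => vecMulVec (v k) (star (v k))) (fun k hki hkj => by rw [hvk k hki hkj]),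
        hvi, hvj, hxy]
  · push Not at hfrac
    set S := I.filter fun i => p i = 1 with hS
    have hcard : S.card = A.card := by
      have h1 : ∑ i ∈ I, p i = S.card := by
        rw [hS, Finset.card_filter]
        push_cast
        refine Finset.sum_congr rfl fun j hj => ?_
        by_cases h0 : p j = 0
        · simp [h0]
        · simp [hfrac j hj h0]
      rw [h1] at hsum
      exact_mod_cast hsum
    set σ : S ≃ A := Finset.equivOfCardEq hcard
    set v : Fin n → Fin (m + 1) → ℂ := fun i =>
      if h : i ∈ S then Pi.single (σ ⟨i, h⟩ : Fin (m + 1)) 1 else 0 with hv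
    refine ⟨v, fun i hi => ?_, ?_⟩
    · by_cases h : i ∈ S
      · have : v i = Pi.single (σ ⟨i, h⟩ : Fin (m + 1)) 1 := by simp only [hv, dif_pos h]
        rw [this, (Finset.mem_filter.1 h).2, dotProduct_single]
        simp
      · have h0 : v i = 0 := by simp only [hv, dif_neg h]
        have h1 : p i = 0 := by
          by_contra hne
          exact h (Finset.mem_filter.2 ⟨hi, hfrac i hi hne⟩)
        rw [h0, h1]
        simp
    · have h1 : ∑ i ∈ I, vecMulVec (v i) (star (v i)) =
          ∑ i ∈ S, vecMulVec (v i) (star (v i)) := by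
        refine (Finset.sum_subset (Finset.filter_subset _ _) fun i _ h => ?_).symm
        have h0 : v i = 0 := dif_neg h
        rw [h0, zero_vecMulVec]
      have h2 : ∑ i ∈ S, vecMulVec (v i) (star (v i)) =
          ∑ a ∈ A, diagonal (Pi.single a (1 : ℂ)) := by
        rw [← Finset.sum_coe_sort S, ← Finset.sum_coe_sort A, ← Equiv.sum_comp σ]
        refine Finset.sum_congr rfl fun i _ => ?_
        have : v i = Pi.single (σ i : Fin (m + 1)) 1 := by simp only [hv, dif_pos i.2]
        rw [this]
        ext a b
        rw [vecMulVec_apply, diagonal_apply]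
        by_cases ha : a = σ i <;> by_cases hb : a = b <;> simp_all [Pi.single_apply]
      rw [h1, h2]
      ext a b
      rw [Matrix.sum_apply, diagonal_apply]
      simp only [diagonal_apply]
      by_cases hab : a = b
      · simp [hab, Pi.single_apply]
      · simp [hab]

/-! ### Critical values of the side-length map -/

theorem smul_vecMulVec_mem_edgeOrbit {v : Fin (m + 1) → ℂ} {p : ℝ} (hp : 0 < p)
    (hv : star v ⬝ᵥ v = p) (c : ℝ) :
    (c : ℂ) • vecMulVec v (star v) ∈ edgeOrbit m (c * p) := by
  have hs : ((Real.sqrt p : ℝ) : ℂ) * (Real.sqrt p : ℝ) = p := by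
    exact_mod_cast Real.mul_self_sqrt hp.le
  have hp0 : (p : ℂ) ≠ 0 := by exact_mod_cast hp.ne'
  have hst : star (((Real.sqrt p : ℝ) : ℂ)⁻¹) = (((Real.sqrt p : ℝ) : ℂ)⁻¹) := by simp
  refine ⟨((Real.sqrt p : ℝ) : ℂ)⁻¹ • v, ?_, ?_⟩
  · rw [star_smul, smul_dotProduct, dotProduct_smul, hv, hst, smul_eq_mul, smul_eq_mul,
      ← mul_assoc, ← mul_inv, hs, inv_mul_cancel₀ hp0]
  · rw [star_smul, smul_vecMulVec, vecMulVec_smul, smul_smul, smul_smul, hst, mul_assoc,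
      ← mul_inv, hs]
    congr 1
    push_cast
    field_simp

theorem diagonal_indicator_posSemidef (A : Finset (Fin (m + 1))) :
    (diagonal fun a => if a ∈ A then (1 : ℂ) else 0).PosSemidef :=
  PosSemidef.diagonal fun a => by by_cases h : a ∈ A <;> simp [h]

theorem length_le_meanLength {r : Fin n → ℝ} (hr : r ∈ cone n m) (i : Fin n) :
    r i ≤ meanLength m r := by
  obtain ⟨hpos, ⟨z⟩⟩ := hr
  obtain ⟨⟨e, he⟩, -⟩ := (isQuotientMap_toOrbit (closedPolygons m r)).surjective z
  have h1 := sum_trace_mul_closedPolygon he (e i)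
  have hnn : ∀ j, 0 ≤ (e i * e j).trace := fun j => by
    have hpsd : (e i).PosSemidef := by
      obtain ⟨w, -, h⟩ := he.1 i
      rw [h]
      exact (posSemidef_vecMulVec_self_star w).smul (by exact_mod_cast (hpos i).le)
    simpa using trace_mul_conj_edge_nonneg (hpos j).le (he.1 j) hpsd 1
  have h2 : (e i * e i).trace = (r i : ℂ) * r i := by
    have := edge_mul_mul_edge (he.1 i) 1
    rw [mul_one, one_mul, trace_edge (he.1 i)] at this
    rw [this, trace_smul, trace_edge (he.1 i), smul_eq_mul]
  have h3 := Finset.single_le_sum (fun j _ => hnn j) (Finset.mem_univ i)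
  rw [h1, h2, trace_edge (he.1 i)] at h3
  have h4 : r i * r i ≤ meanLength m r * r i := by exact_mod_cast h3
  exact le_of_mul_le_mul_right h4 (hpos i)

/-- For side lengths on a wall there is a closed polygon that decomposes as the direct sum of
closed polygons in two orthogonal coordinate subspaces. -/
theorem exists_decomposable {r : Fin n → ℝ} {I J : Finset (Fin n)} {k : ℕ}
    (hIJ : IsProperPartition I J) (hk : k ≤ m) (hr : r ∈ wall m I J k) :
    ∃ e ∈ closedPolygons m r, ∃ A : Finset (Fin (m + 1)), A.card = m + 1 - k ∧
      (∀ i ∈ J, ((diagonal fun a => if a ∈ A then (1 : ℂ) else 0) * e i).trace = 0) ∧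
      ∀ i ∈ I, ((diagonal fun a => if a ∈ Aᶜ then (1 : ℂ) else 0) * e i).trace = 0 := by
  classical
  obtain ⟨⟨hpos, hwall⟩, hcone⟩ := hr
  obtain ⟨hdisj, hunion, hI, hJ⟩ := hIJ
  have hn : 0 < n := by
    obtain ⟨i, -⟩ := hI
    exact i.pos
  have hL : 0 < meanLength m r := meanLength_pos hn hpos
  have hJI : ∀ i, i ∉ I → i ∈ J := fun i hi =>
    (Finset.mem_union.1 (hunion ▸ Finset.mem_univ i)).resolve_left hi
  have htot : ∑ i ∈ I, r i + ∑ j ∈ J, r j = meanLength m r * ((m : ℝ) + 1) := by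
    rw [meanLength_mul, ← Finset.sum_union hdisj, hunion]
  have hsJ : ∑ j ∈ J, r j = meanLength m r * k := by
    have h1 : ((m : ℝ) + 1) * ∑ j ∈ J, r j = ((m : ℝ) + 1) * (meanLength m r * k) := by
      linear_combination (k : ℝ) * htot - hwall
    exact mul_left_cancel₀ (by positivity) h1
  have hsI : ∑ i ∈ I, r i = meanLength m r * ((m : ℝ) + 1 - k) := by
    linear_combination htot - hsJ
  obtain ⟨A, -, hA⟩ := Finset.exists_subset_card_eq
    (s := (Finset.univ : Finset (Fin (m + 1)))) (n := m + 1 - k) (by simp)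
  have hAc : Aᶜ.card = k := by rw [Finset.card_compl, Fintype.card_fin, hA]; omega
  have hp : ∀ i, 0 ≤ r i / meanLength m r ∧ r i / meanLength m r ≤ 1 := fun i =>
    ⟨(div_pos (hpos i) hL).le, (div_le_one hL).2 (length_le_meanLength hcone i)⟩
  obtain ⟨v, hv, hvs⟩ := exists_frame A I (fun i => r i / meanLength m r) (fun i _ => hp i) (by
    rw [← Finset.sum_div, hsI, hA, Nat.cast_sub (by omega)]
    push_cast
    field_simp)
  obtain ⟨w, hw, hws⟩ := exists_frame Aᶜ J (fun i => r i / meanLength m r) (fun i _ => hp i) (by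
    rw [← Finset.sum_div, hsJ, hAc]
    field_simp)
  set x : Fin n → Fin (m + 1) → ℂ := fun i => if i ∈ I then v i else w i with hx
  have hxI : ∀ i ∈ I, x i = v i := fun i hi => if_pos hi
  have hxJ : ∀ i ∈ J, x i = w i := fun i hi =>
    if_neg fun h => Finset.disjoint_left.1 hdisj h hi
  set e : Tuple n m := fun i => (meanLength m r : ℂ) • vecMulVec (x i) (star (x i)) with he
  have hedge : ∀ i, e i ∈ edgeOrbit m (r i) := by
    intro i
    have hxi : star (x i) ⬝ᵥ x i = ((r i / meanLength m r : ℝ) : ℂ) := by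
      by_cases hi : i ∈ I
      · rw [hxI i hi, hv i hi]
      · rw [hxJ i (hJI i hi), hw i (hJI i hi)]
    have := smul_vecMulVec_mem_edgeOrbit (div_pos (hpos i) hL) hxi (meanLength m r)
    rwa [mul_div_cancel₀ _ hL.ne'] at this
  have heI : ∑ i ∈ I, e i =
      (meanLength m r : ℂ) • diagonal fun a => if a ∈ A then (1 : ℂ) else 0 := by
    rw [← hvs, Finset.smul_sum]
    exact Finset.sum_congr rfl fun i hi => by simp only [he, hxI i hi]
  have heJ : ∑ i ∈ J, e i =
      (meanLength m r : ℂ) • diagonal fun a => if a ∈ Aᶜ then (1 : ℂ) else 0 := by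
    rw [← hws, Finset.smul_sum]
    exact Finset.sum_congr rfl fun i hi => by simp only [he, hxJ i hi]
  -- nonnegative traces with sum zero vanish
  have hvanish : ∀ (K : Finset (Fin n)) (B C : Finset (Fin (m + 1))), Disjoint B C →
      ∑ i ∈ K, e i = (meanLength m r : ℂ) • (diagonal fun a => if a ∈ C then (1 : ℂ) else 0) →
      ∀ i ∈ K, ((diagonal fun a => if a ∈ B then (1 : ℂ) else 0) * e i).trace = 0 := by
    intro K B C hBC hK
    refine (Finset.sum_eq_zero_iff_of_nonneg fun i _ => ?_).1 ?_
    · simpa using trace_mul_conj_edge_nonneg (hpos i).le (hedge i)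
        (diagonal_indicator_posSemidef B) 1
    · rw [← trace_sum, ← Finset.mul_sum, hK, Matrix.mul_smul, diagonal_mul_diagonal]
      have : (fun a => (if a ∈ B then (1 : ℂ) else 0) * if a ∈ C then 1 else 0) = 0 := by
        funext a
        by_cases hB : a ∈ B
        · simp [Finset.disjoint_left.1 hBC hB]
        · simp [hB]
      rw [this]
      simp
  refine ⟨e, ⟨hedge, ?_⟩, A, hA, hvanish J A Aᶜ disjoint_compl_right heJ,
    hvanish I Aᶜ A disjoint_compl_left heI⟩
  rw [← hunion, Finset.sum_union hdisj, heI, heJ, ← smul_add, diagonal_add]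
  have : (fun a => (if a ∈ A then (1 : ℂ) else 0) + if a ∈ Aᶜ then 1 else 0) = fun _ => 1 := by
    funext a
    by_cases h : a ∈ A <;> simp [h]
  rw [this, diagonal_one, hunion]
  rfl

theorem hasDerivAt_trace_mul {γ : ℝ → Tuple n m} {v : Tuple n m} {t : ℝ} (h : HasDerivAt γ v t)
    (Q : Matrix (Fin (m + 1)) (Fin (m + 1)) ℂ) (i : Fin n) :
    HasDerivAt (fun t => (Q * γ t i).trace.re) (Q * v i).trace.re t := by
  set l : Tuple n m →ₗ[ℝ] ℝ :=
    { toFun := fun e => (Q * e i).trace.re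
      map_add' := fun e e' => by
        rw [Pi.add_apply, mul_add, trace_add, Complex.add_re]
      map_smul' := fun c e => by
        rw [Pi.smul_apply, Matrix.mul_smul, trace_smul, Complex.smul_re]
        rfl }
  exact (LinearMap.toContinuousLinearMap l).hasFDerivAt.comp_hasDerivAt t h

theorem hasDerivAt_sideLength {γ : ℝ → Tuple n m} {v : Tuple n m} {t : ℝ}
    (h : HasDerivAt γ v t) : HasDerivAt (fun t => sideLength (γ t)) (sideLength v) t := by
  rw [hasDerivAt_pi]
  intro i
  have h1 := hasDerivAt_trace_mul h 1 i
  simp only [one_mul] at h1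
  exact h1

theorem fderiv_sideLength_apply (e v : Tuple n m) :
    fderiv ℝ (sideLength : Tuple n m → Fin n → ℝ) e v = sideLength v := by
  have hline : HasDerivAt (fun t : ℝ => e + t • v) v 0 := by
    exact (((hasDerivAt_id (0 : ℝ)).smul_const v).const_add e).congr_deriv (one_smul ℝ v)
  have hd : DifferentiableAt ℝ (sideLength : Tuple n m → Fin n → ℝ) (e + (0 : ℝ) • v) :=
    (contDiff_sideLength (k := 1)).differentiable one_ne_zero _
  have h1 := hd.hasFDerivAt.comp_hasDerivAt (0 : ℝ) hline
  rw [zero_smul, add_zero] at h1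
  exact h1.unique (hasDerivAt_sideLength hline)

/-- At a decomposable polygon the total lengths of the two groups of edges cannot be changed
independently. -/
theorem wallUnion_subset_criticalValues : wallUnion n m ⊆
    criticalValues (CPol n m) (sideLength : Tuple n m → Fin n → ℝ) := by
  classical
  rintro r ⟨I, J, k, hIJ, hk1, hkm, hr⟩
  obtain ⟨e, he, A, hA, hQJ, hQI⟩ := exists_decomposable hIJ hkm hr
  refine ⟨e, ⟨r, hr.1.1, he⟩, sideLength_of_mem he.1, fun hsurj => ?_⟩
  obtain ⟨i₀, hi₀⟩ := hIJ.2.2.1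
  obtain ⟨v, ⟨γ, ε, hε, hγ, hmem, hγ0, hv⟩, hvρ⟩ :=
    hsurj (Set.mem_univ (Pi.single i₀ (1 : ℝ)))
  replace hvρ : sideLength v = Pi.single i₀ 1 := (fderiv_sideLength_apply e v).symm.trans hvρ
  have hev : ∀ᶠ t in 𝓝 (0 : ℝ), γ t ∈ CPol n m := by
    filter_upwards [Ioo_mem_nhds (neg_lt_zero.2 hε) hε] with t ht using hmem t ht
  -- a nonnegative trace that vanishes at time zero has a minimum there
  have hmin : ∀ (B : Finset (Fin (m + 1))) (i : Fin n),
      ((diagonal fun a => if a ∈ B then (1 : ℂ) else 0) * e i).trace = 0 →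
      ((diagonal fun a => if a ∈ B then (1 : ℂ) else 0) * v i).trace.re = 0 := by
    intro B i h0
    refine IsLocalMin.hasDerivAt_eq_zero ?_ (hasDerivAt_trace_mul hv _ i)
    filter_upwards [hev] with t ht
    rw [hγ0, h0]
    obtain ⟨s, hs, hst⟩ := ht
    have := trace_mul_conj_edge_nonneg (hs i).le (hst.1 i) (diagonal_indicator_posSemidef B) 1
    rw [one_mul, conjTranspose_one, mul_one] at this
    exact (Complex.nonneg_iff.1 this).1
  set Q : Matrix (Fin (m + 1)) (Fin (m + 1)) ℂ := diagonal fun a => if a ∈ A then (1 : ℂ) else 0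
    with hQ
  have htrQ : Q.trace = A.card := by simp [hQ, trace_diagonal]
  have hJ0 : ∀ i ∈ J, (Q * v i).trace.re = 0 := fun i hi => hmin A i (hQJ i hi)
  have hI0 : ∀ i ∈ I, (Q * v i).trace.re = sideLength v i := by
    intro i hi
    have h1 := hmin Aᶜ i (hQI i hi)
    have h2 : (diagonal fun a => if a ∈ Aᶜ then (1 : ℂ) else 0) = 1 - Q := by
      rw [eq_sub_iff_add_eq, hQ, diagonal_add, ← diagonal_one]
      congr 1
      funext a
      by_cases h : a ∈ A <;> simp [h]
    rw [h2, sub_mul, one_mul, trace_sub, Complex.sub_re, sub_eq_zero] at h1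
    exact h1.symm
  have hclosed : ∑ i, (Q * v i).trace.re = meanLength m (sideLength v) * A.card := by
    have h1 : HasDerivAt (fun t => ∑ i, (Q * γ t i).trace.re) (∑ i, (Q * v i).trace.re) 0 :=
      HasDerivAt.fun_sum fun i _ => hasDerivAt_trace_mul hv Q i
    have h2 : HasDerivAt (fun t => meanLength m (sideLength (γ t)) * (A.card : ℝ))
        (meanLength m (sideLength v) * A.card) 0 :=
      ((HasDerivAt.fun_sum fun i _ => hasDerivAt_pi.1 (hasDerivAt_sideLength hv) i).div_const
        _).mul_const _
    refine h1.unique (h2.congr_of_eventuallyEq ?_)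
    filter_upwards [hev] with t ht
    have h3 := sum_trace_mul_closedPolygon (closedPolygons_of_mem_CPol ht).2 Q
    rw [htrQ] at h3
    have h4 := congrArg Complex.re h3
    rw [Complex.re_sum, Complex.re_ofReal_mul, Complex.natCast_re] at h4
    exact h4
  have hsumI : ∑ i, (Q * v i).trace.re = 1 := by
    rw [← hIJ.2.1, Finset.sum_union hIJ.1, Finset.sum_eq_zero hJ0, add_zero,
      Finset.sum_congr rfl hI0, hvρ, Finset.sum_pi_single', if_pos hi₀]
  have hmean : meanLength m (sideLength v) = 1 / ((m : ℝ) + 1) := by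
    rw [hvρ, meanLength, Finset.sum_pi_single', if_pos (Finset.mem_univ _)]
  -- lengthening a single edge in `I` violates the equation of the wall
  rw [hsumI, hmean, hA, Nat.cast_sub (by omega)] at hclosed
  have hm : (0 : ℝ) < (m : ℝ) + 1 := by positivity
  have hk0 : (1 : ℝ) ≤ k := by exact_mod_cast hk1
  push_cast at hclosed
  field_simp at hclosed
  linarith

theorem mem_cone_of_mem_closedPolygons {r : Fin n → ℝ} (hr : ∀ i, 0 < r i) {e : Tuple n m}
    (he : e ∈ closedPolygons m r) : r ∈ cone n m := ⟨hr, ⟨toOrbit _ ⟨e, he⟩⟩⟩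

/-- Off the walls the side lengths of a closed polygon can be changed in any direction. -/
theorem criticalValues_subset_wallUnion :
    criticalValues (CPol n m) (sideLength : Tuple n m → Fin n → ℝ) ⊆ wallUnion n m := by
  rintro r ⟨e, ⟨s, hr, he⟩, hside, hcrit⟩
  rw [sideLength_of_mem he.1] at hside
  subst hside
  by_contra hw
  refine hcrit fun ρ _ => ?_
  rcases Nat.eq_zero_or_pos n with rfl | hn
  · exact ⟨0, ⟨fun _ => e, 1, one_pos, contDiffOn_const, fun _ _ => ⟨s, hr, he⟩, rfl,
      hasDerivAt_const _ _⟩, Subsingleton.elim _ _⟩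
  obtain ⟨γ, hγ, hγ1, hbal⟩ := exists_local_balancing hn
    (mem_cone_of_mem_closedPolygons hr he) hw hr he.1 (balances_one hr he)
  set c : ℝ → (Fin n → ℝ) × Tuple n m := fun t => (s + t • ρ, e) with hc
  have hcc : ContDiff ℝ ω c :=
    (contDiff_const.add (contDiff_id.smul contDiff_const)).prodMk contDiff_const
  have hc0 : c 0 = (s, e) := by simp [hc]
  set F : ℝ → Tuple n m := fun t => rescale (c t).1 (γ (c t)) (c t).2 with hF
  have hF0 : F 0 = e := by
    rw [hF]
    simp only [hc0, hγ1]
    exact rescale_one hr he.1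
  have hFcd : ContDiffAt ℝ ω F 0 := by
    rw [← hc0] at hγ
    refine contDiffAt_rescale hcc.contDiffAt.fst (hγ.comp 0 hcc.contDiffAt) hcc.contDiffAt.snd
      fun i => ?_
    rw [hc0, hγ1]
    exact trace_mul_edge_mul_ne_zero (hr i) (he.1 i) PosDef.one
  have hct : Tendsto c (𝓝 0) (𝓝 (s, e)) := hc0 ▸ hcc.continuous.tendsto 0
  have hposev : ∀ᶠ t in 𝓝 (0 : ℝ), ∀ i, 0 < (c t).1 i := by
    rw [eventually_all]
    intro i
    have h1 : Tendsto (fun t => (c t).1 i) (𝓝 0) (𝓝 (s i)) :=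
      ((continuous_apply i).comp continuous_fst).continuousAt.tendsto.comp hct
    exact h1.eventually (lt_mem_nhds (hr i))
  have hall : ∀ᶠ t in 𝓝 (0 : ℝ), ContDiffAt ℝ ω F t ∧ (∀ i, 0 < (c t).1 i) ∧
      F t ∈ closedPolygons m (c t).1 := by
    filter_upwards [hFcd.eventually (by simp), hposev, hct.eventually hbal] with t h1 h2 h3
    exact ⟨h1, h2, (h3 s hr he.1).2⟩
  obtain ⟨ε, hε, hball⟩ := Metric.eventually_nhds_iff_ball.1 hall
  rw [Real.ball_eq_Ioo, zero_sub, zero_add] at hball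
  have hderiv : HasDerivAt F (deriv F 0) 0 :=
    (hFcd.differentiableAt (by simp)).hasDerivAt
  refine ⟨deriv F 0, ⟨F, ε, hε, fun t ht => ((hball t ht).1.of_le le_top).contDiffWithinAt,
    fun t ht => ⟨_, (hball t ht).2⟩, hF0, hderiv⟩, ?_⟩
  have h1 : HasDerivAt (fun t : ℝ => s + t • ρ) ρ 0 := by
    simpa using ((hasDerivAt_id (0 : ℝ)).smul_const ρ).const_add s
  refine (fderiv_sideLength_apply e _).trans
    ((hasDerivAt_sideLength hderiv).unique (h1.congr_of_eventuallyEq ?_))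
  filter_upwards [hall] with t ht
  exact sideLength_of_mem ht.2.2.1

theorem IsChamber.subset {D : Set (Fin n → ℝ)} (hD : IsChamber n m D) :
    D ⊆ cone n m \ wallUnion n m := by
  obtain ⟨r, -, rfl⟩ := hD
  exact connectedComponentIn_subset _ _

theorem IsChamber.isPreconnected {D : Set (Fin n → ℝ)} (hD : IsChamber n m D) :
    IsPreconnected D := by
  obtain ⟨r, -, rfl⟩ := hD
  exact isPreconnected_connectedComponentIn

end PolygonSpace

end

theorem mainTheorem3 (n m : ℕ) :
    PolygonSpace.criticalValues (PolygonSpace.CPol n m)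
        (PolygonSpace.sideLength : PolygonSpace.Tuple n m → Fin n → ℝ) =
      PolygonSpace.wallUnion n m ∧
    ∀ D : Set (Fin n → ℝ), PolygonSpace.IsChamber n m D →
      (∀ r ∈ D, PolygonSpace.IsTrivialBundleOver m D r ∧
        PolygonSpace.IsTrivialQuotientBundleOver m D r) ∧
      (∀ r ∈ D, ∀ r' ∈ D, PolygonSpace.ModuliDiffeomorphic m r r') := by
  refine ⟨Set.Subset.antisymm PolygonSpace.criticalValues_subset_wallUnion
    PolygonSpace.wallUnion_subset_criticalValues, fun D hD => ?_⟩
  obtain ⟨T, hT⟩ := PolygonSpace.exists_isTransport hD.subset hD.isPreconnected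
  have hcone : D ⊆ PolygonSpace.cone n m := fun r hr => (hD.subset hr).1
  exact ⟨fun r hr => ⟨hT.isTrivialBundleOver hcone hr, hT.isTrivialQuotientBundleOver hcone hr⟩,
    fun r hr r' hr' => hT.moduliDiffeomorphic hr hr'⟩
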